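/- **Theorem 5.1.** Let $p$ be a prime, let $K$ be a finite extension of $\mathbb{Q}_p$, and let $\overline{K}$ be an algebraic closure of $K$. Let $v$ be the valuation on $\overline{K}$ extending the $p$-adic valuation, normalized by $v(p)=1$ (and $v(0)=\infty$). Let $a,c\in K$, and let $f(z)=z^p-c$. For $n\ge 0$ let $f^n$ be the $n$-th iterate of $f$, let $f^{-n}(a)$ be the set of solutions of $f^n(z)=a$ in $\overline{K}$, and let $K_n=K(f^{-n}(a))$; let $K_\infty=\bigcup_{n} K_n$. For $0\le n\le\infty$ let $G(n)=\operatorname{Aut}(K_n/K)$, with the Krull topology, and let $I(n)\le G(n)$ be the inertia subgroup, i.e. the subgroup of automorphisms acting trivially on the residue field of $K_n$. Let $\mu_p$ be the group of $p$-th roots of unity in $\overline{K}$. Suppose that $v(c)=-p/(p-1)$, and let $b\in\overline{K}$ be a fixed point of $f$. Then: (a) If $\mu_p\subset K$, then for every $0\le n<\infty$ the group $G(n)/I(n)$ is a cyclic $p$-group. (b) For every $0\le n<\infty$ the group $I(n)$ is a $p$-group. (c) If $v(a)>v(c)$, then for every $0\le n<\infty$ the group $I(n)$ is an elementary abelian $p$-group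 of order dividing $p^n$. (d) If $\mu_p\subset K$, then $G(\infty)/I(\infty)\cong\mathbb{Z}_p$ as topological groups. (e) If $v(a-b)<0$, then $I(\infty)$ is an infinite pro-$p$ group; if, moreover, $v(a)>v(c)$, then $I(\infty)$ is isomorphic, as a topological group, to the product $(\mathbb{Z}/p\mathbb{Z})^{\infty}$ of countably infinitely many copies of $\mathbb{Z}/p\mathbb{Z}$. (f) If $v(a-b)\ge 0$, then $I(\infty)$ is finite; if, moreover, $b\in K$, then $I(\infty)=\{1\}$. -/

import Mathlib

namespace Arboreal

/-- The valuation on an algebraic extension `L` of `ℚ_p` that extends the `p`-adic valuation,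
normalized by `v(p) = 1`, with `v(0) = ∞`. (`spectralNorm` is the unique extension to `L` of the
`p`-adic absolute value.) -/
noncomputable def val (p : ℕ) [Fact p.Prime] {L : Type*} [Field L] [Algebra ℚ_[p] L] (x : L) :
    WithTop ℝ :=
  open Classical in
  if x = 0 then ⊤ else ((-Real.logb (p : ℝ) (spectralNorm ℚ_[p] L x) : ℝ) : WithTop ℝ)

theorem one_lt_cast (p : ℕ) [hp : Fact p.Prime] : (1 : ℝ) < p := by
  exact_mod_cast hp.out.one_lt

theorem zero_le_val_iff {p : ℕ} [Fact p.Prime] {L : Type*} [Field L] [Algebra ℚ_[p] L]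
    [Algebra.IsAlgebraic ℚ_[p] L] (x : L) : 0 ≤ val p x ↔ spectralNorm ℚ_[p] L x ≤ 1 := by
  unfold val
  split_ifs with h
  · simp [h, spectralNorm_zero]
  · rw [← WithTop.coe_zero, WithTop.coe_le_coe, neg_nonneg, Real.logb_nonpos_iff (one_lt_cast p)
      (spectralNorm_zero_lt h (Algebra.IsAlgebraic.isAlgebraic x))]

theorem zero_lt_val_iff {p : ℕ} [Fact p.Prime] {L : Type*} [Field L] [Algebra ℚ_[p] L]
    [Algebra.IsAlgebraic ℚ_[p] L] (x : L) : 0 < val p x ↔ spectralNorm ℚ_[p] L x < 1 := by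
  unfold val
  split_ifs with h
  · simp [h, spectralNorm_zero]
  · rw [← WithTop.coe_zero, WithTop.coe_lt_coe, neg_pos, Real.logb_neg_iff (one_lt_cast p)
      (spectralNorm_zero_lt h (Algebra.IsAlgebraic.isAlgebraic x))]

/-- The set of solutions in `Kbar` of `f^n(z) = a`, where `f^n` is the `n`-th iterate of `f`. -/
def preimages {K : Type*} [Field K] (Kbar : Type*) [Field Kbar] [Algebra K Kbar]
    (f : Polynomial K) (a : K) (n : ℕ) : Set Kbar :=
  {z | (fun x : Kbar => Polynomial.aeval x f)^[n] z = algebraMap K Kbar a}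

/-- `K_n = K(f^{-n}(a))`. -/
noncomputable def levelField {K : Type*} [Field K] (Kbar : Type*) [Field Kbar] [Algebra K Kbar]
    (f : Polynomial K) (a : K) (n : ℕ) : IntermediateField K Kbar :=
  IntermediateField.adjoin K (preimages Kbar f a n)

/-- `K_∞`, the union (equivalently, since the `K_n` increase, the compositum) of the `K_n`. -/
noncomputable def limitField {K : Type*} [Field K] (Kbar : Type*) [Field Kbar] [Algebra K Kbar]
    (f : Polynomial K) (a : K) : IntermediateField K Kbar :=
  ⨆ n : ℕ, levelField Kbar f a n

theorem isAlgebraic_padic (p : ℕ) [Fact p.Prime] (K Kbar : Type*) [Field K] [Algebra ℚ_[p] K]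
    [FiniteDimensional ℚ_[p] K] [Field Kbar] [Algebra K Kbar] [Algebra ℚ_[p] Kbar]
    [IsScalarTower ℚ_[p] K Kbar] [IsAlgClosure K Kbar] : Algebra.IsAlgebraic ℚ_[p] Kbar :=
  have : Algebra.IsAlgebraic K Kbar := IsAlgClosure.isAlgebraic
  Algebra.IsAlgebraic.trans ℚ_[p] K Kbar

theorem val_aut (p : ℕ) [Fact p.Prime] {K Kbar : Type*} [Field K] [Algebra ℚ_[p] K]
    [Field Kbar] [Algebra K Kbar] [Algebra ℚ_[p] Kbar] [IsScalarTower ℚ_[p] K Kbar]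
    (E : IntermediateField K Kbar) (σ : E ≃ₐ[K] E) (x : E) :
    val p (σ x : Kbar) = val p (x : Kbar) := by
  have h (y : E) : minpoly ℚ_[p] (y : Kbar) = minpoly ℚ_[p] y :=
    minpoly.algHom_eq (E.val.restrictScalars ℚ_[p]) Subtype.val_injective y
  have h2 : spectralNorm ℚ_[p] Kbar (σ x : Kbar) = spectralNorm ℚ_[p] Kbar (x : Kbar) := by
    unfold spectralNorm
    rw [h, h]
    exact congrArg _ (minpoly.algEquiv_eq (σ.restrictScalars ℚ_[p]) x)
  have h3 : (σ x : Kbar) = 0 ↔ (x : Kbar) = 0 := by simp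
  unfold val
  by_cases hx : (x : Kbar) = 0
  · rw [if_pos hx, if_pos (h3.2 hx)]
  · rw [if_neg hx, if_neg (fun h4 => hx (h3.1 h4)), h2]

/-- The inertia subgroup of `Aut(E/K)`: the automorphisms that act trivially on the residue field
of `E`, that is, `v(σ x - x) > 0` for every `x` in the valuation ring of `E`. -/
def inertia (p : ℕ) [Fact p.Prime] {K Kbar : Type*} [Field K] [Algebra ℚ_[p] K]
    [FiniteDimensional ℚ_[p] K] [Field Kbar] [Algebra K Kbar] [Algebra ℚ_[p] Kbar]
    [IsScalarTower ℚ_[p] K Kbar] [IsAlgClosure K Kbar] (E : IntermediateField K Kbar) :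
    Subgroup (E ≃ₐ[K] E) where
  carrier := {σ | ∀ x : E, 0 ≤ val p (x : Kbar) → 0 < val p ((σ x : Kbar) - (x : Kbar))}
  one_mem' := by
    intro x _
    simp [val]
  mul_mem' := by
    intro σ τ hσ hτ x hx
    have := isAlgebraic_padic p K Kbar
    have h1 := hσ (τ x) (by rwa [val_aut p E τ x])
    have h2 := hτ x hx
    rw [zero_lt_val_iff] at h1 h2 ⊢
    have h3 := isNonarchimedean_spectralNorm (K := ℚ_[p]) (L := Kbar)
      ((σ (τ x) : Kbar) - (τ x : Kbar)) ((τ x : Kbar) - (x : Kbar))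
    rw [sub_add_sub_cancel] at h3
    exact lt_of_le_of_lt h3 (max_lt h1 h2)
  inv_mem' := by
    intro σ hσ x hx
    have := isAlgebraic_padic p K Kbar
    have h1 := hσ (σ⁻¹ x) (by rwa [val_aut p E σ⁻¹ x])
    have h2 : σ (σ⁻¹ x) = x := AlgEquiv.apply_symm_apply σ x
    rw [h2, zero_lt_val_iff, ← spectralNorm_neg (Algebra.IsAlgebraic.isAlgebraic _), neg_sub] at h1
    rwa [zero_lt_val_iff]

instance inertia_normal (p : ℕ) [Fact p.Prime] {K Kbar : Type*} [Field K] [Algebra ℚ_[p] K]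
    [FiniteDimensional ℚ_[p] K] [Field Kbar] [Algebra K Kbar] [Algebra ℚ_[p] Kbar]
    [IsScalarTower ℚ_[p] K Kbar] [IsAlgClosure K Kbar] (E : IntermediateField K Kbar) :
    (inertia p E).Normal where
  conj_mem := by
    intro σ hσ τ x hx
    have h1 := hσ (τ⁻¹ x) (by rwa [val_aut p E τ⁻¹ x])
    have h2 : (τ * σ * τ⁻¹) x - x = τ (σ (τ⁻¹ x) - τ⁻¹ x) := by
      rw [map_sub]
      congr 1
      exact (AlgEquiv.apply_symm_apply τ x).symm
    have h3 : (((τ * σ * τ⁻¹) x : E) : Kbar) - (x : Kbar) =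
        ((τ (σ (τ⁻¹ x) - τ⁻¹ x) : E) : Kbar) := by
      rw [← h2]; rfl
    rw [h3, val_aut p E τ]
    exact h1

/-- A group is an elementary abelian `p`-group if it is commutative of exponent dividing `p`. -/
def IsElementaryAbelian (p : ℕ) (G : Type*) [Group G] : Prop :=
  (∀ x y : G, x * y = y * x) ∧ ∀ x : G, x ^ p = 1

/-- A pro-`p` group: a profinite group in which every open normal subgroup has `p`-power index. -/
def IsProP (p : ℕ) (G : Type*) [Group G] [TopologicalSpace G] : Prop :=
  IsTopologicalGroup G ∧ CompactSpace G ∧ T2Space G ∧ TotallyDisconnectedSpace G ∧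
    ∀ N : Subgroup G, N.Normal → IsOpen (N : Set G) → ∃ k : ℕ, N.index = p ^ k

end Arboreal

/-!
Multiplicatively, put `β = p ^ (1 / (p - 1))`, so that the hypothesis reads `|c| = β ^ p`. The fixed
points of `f` have absolute value `β`, and so have all proper iterated preimages of a point `y` with
`v(y) > v(c)`. The reason for everything is the shape of `f` near a point `y` with `|y| = β`: in
`(y + w) ^ p - y ^ p` the linear coefficient `p y ^ (p - 1)` is a unit and the remaining ones are
integral, so on the unit disc `f` reduces to a separable additive polynomial `w ^ p + u w` with
`u ≠ 0`, while it raises distances greater than `1` to the `p`-th power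
(`val_add_pow_sub_of_lt`, `val_add_pow_sub_of_gt`). Three consequences are used.

* Distinct points on the same level of the tree over a point `y` with `v(y) > v(c)` are at
  distance exactly `1` (`val_sub_eq_one_of_iterate`). Hence an inertia element acts on such a level
  as a translation modulo the maximal ideal: the action is free, two of them commute, and the `p`-th
  power acts trivially (`inertia_free_on_levelSet`, `isElementaryAbelian_inertia`). As every tree
  contains such points `y` (`exists_iterate_root_lt`), the residue field of `K_∞` is infinite.
* If `|a - b| ≤ 1`, then the whole tree lies in the unit disc around `b`, which contains `a`, so
  inertia fixes all its points (`inertia_eq_bot_of_integral`).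
* If `|a - b| > 1`, then the points `z` of level `n` satisfy `|z - b| ^ p ^ n = |a - b|`, and the
  value group of `K_∞` is not discrete (`val_sub_iterate_pow`).

An automorphism that fixes `μ_p` has `p`-power order on each level (`pow_apply_levelSet`), because
each step of the tree is a Kummer extension. Inertia fixes `μ_p` even if `μ_p` is not contained
in `K`, because `p c ∈ K` has absolute value `β`, which makes the elements `ζ p c` pairwise
incongruent modulo the maximal ideal, but with integral differences
(`inertia_fixes_roots_of_unity`). This gives the statements on `p`-groups.

By compactness, membership in an open subgroup that contains `I` is detected by the action on
finitely many residue classes. As finite fields have cyclic automorphism groups, the finite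
quotients of `Aut(E/K) / I` are cyclic (`exists_generator_mod_open`). If `I(∞)` had finite index
in `G(∞)`, all residue classes of `K_∞` would lift to its fixed field, a finite extension of `K`
with a finite residue field (`infinite_quotient_inertia`). An infinite profinite group whose finite
quotients are cyclic `p`-groups is `ℤ_p` (`nonempty_continuousMulEquiv_padicInt`).

If `I(∞)` were finite, then `K_∞ / T` would be unramified for some finite extension `T` of `K`. By a
trace argument that rests on the linear independence of characters, `T` would have the same values
as `K_∞` (`exists_invariant_val_eq`, `exists_fixed_absVal_eq`), which contradicts the last of the
three consequences (`infinite_inertia_of_absVal`). An infinite profinite group that is elementary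
abelian and metrizable is a countable power of `ℤ/p`, through a basis of its character group
(`nonempty_continuousMulEquiv_pi_zmod`).
-/

open scoped NNReal

namespace Arboreal

/-! ### The map `z ↦ z ^ p` near points of absolute value `p ^ (1 / (p - 1))` -/

section ValuationArithmetic

variable {L : Type*} [Field L] (v : Valuation L ℝ≥0) {p : ℕ} [hp : Fact p.Prime] {β : ℝ≥0}

theorem one_lt_of_pow_pred_eq (hβ : β ^ (p - 1) = p) : 1 < β := by
  by_contra! h
  have h1 : (p : ℝ≥0) ≤ 1 := hβ ▸ pow_le_one₀ zero_le h
  exact absurd (by exact_mod_cast h1 : p ≤ 1) (not_le.2 hp.out.one_lt)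

theorem val_natCast_le_one (n : ℕ) : v (n : L) ≤ 1 := by
  induction n with
  | zero => simp
  | succ k ih => exact_mod_cast v.map_add_le ih v.map_one.le

/-- The terms of the binomial expansion of `(y + w) ^ p` other than `y ^ p` are bounded by powers
of `w` alone: `|p|` compensates the size of `y`. -/
theorem val_binomial_term_le (hvp : v (p : L) = (p : ℝ≥0)⁻¹) (hβ : β ^ (p - 1) = p) {y w : L}
    (hy : v y = β) {k : ℕ} (hk : k < p) :
    v (y ^ k * w ^ (p - k) * (p.choose k : L)) ≤ v w ^ (p - k) := by
  have h1 : v y ^ k * v (p.choose k : L) ≤ 1 := by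
    rcases Nat.eq_zero_or_pos k with rfl | hk0
    · simp
    · obtain ⟨d, hd⟩ := hp.out.dvd_choose_self hk0.ne' hk
      have hβ1 := one_lt_of_pow_pred_eq hβ
      have hp0 : (p : ℝ≥0) ≠ 0 := by exact_mod_cast hp.out.ne_zero
      rw [hd, Nat.cast_mul, map_mul, hvp, hy]
      calc β ^ k * ((p : ℝ≥0)⁻¹ * v (d : L)) ≤ β ^ (p - 1) * ((p : ℝ≥0)⁻¹ * 1) := by
            gcongr
            · exact hβ1.le
            · omega
            · exact val_natCast_le_one v d
        _ = 1 := by rw [hβ, mul_one, mul_inv_cancel₀ hp0]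
  rw [map_mul, map_mul, map_pow, map_pow, mul_right_comm]
  exact mul_le_of_le_one_left zero_le h1

theorem val_add_pow_sub_of_lt (hvp : v (p : L) = (p : ℝ≥0)⁻¹) (hβ : β ^ (p - 1) = p) {y w : L}
    (hy : v y = β) (hw : v w < 1) : v ((y + w) ^ p - y ^ p) = v w := by
  rcases eq_or_ne w 0 with rfl | hw0
  · simp
  obtain ⟨m, rfl⟩ : ∃ m, p = m + 2 := ⟨p - 2, by have := hp.out.two_le; omega⟩
  have hp0 : ((m + 2 : ℕ) : ℝ≥0) ≠ 0 := by exact_mod_cast hp.out.ne_zero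
  rw [add_pow, Finset.sum_range_succ, Finset.sum_range_succ]
  have hmain : v (y ^ (m + 1) * w ^ (m + 2 - (m + 1)) * ((m + 2).choose (m + 1) : L)) = v w := by
    have : (m + 2).choose (m + 1) = m + 2 := Nat.choose_succ_self_right (m + 1)
    rw [this, map_mul, map_mul, map_pow, map_pow, hy, hvp]
    have h2 : m + 2 - (m + 1) = 1 := by omega
    have h3 : m + 2 - 1 = m + 1 := by omega
    rw [h3] at hβ
    rw [h2, hβ, pow_one, mul_right_comm, mul_inv_cancel₀ hp0, one_mul]
  have hsum : v (∑ k ∈ Finset.range (m + 1), y ^ k * w ^ (m + 2 - k) * ((m + 2).choose k : L))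
      < v w := by
    refine v.map_sum_lt (v.ne_zero_iff.2 hw0) fun k hk => ?_
    have hk := Finset.mem_range.1 hk
    refine (val_binomial_term_le v hvp hβ hy (by omega)).trans_lt ?_
    calc v w ^ (m + 2 - k) ≤ v w ^ 2 := pow_le_pow_of_le_one zero_le hw.le (by omega)
      _ = v w * v w := sq _
      _ < v w := mul_lt_of_lt_one_right (zero_lt_iff.2 (v.ne_zero_iff.2 hw0)) hw
  rw [← hmain] at hsum
  simp only [Nat.sub_self, pow_zero, mul_one, Nat.choose_self, Nat.cast_one, add_sub_cancel_right]
  rw [v.map_add_eq_of_lt_right hsum, hmain]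

theorem val_add_pow_sub_le_one (hvp : v (p : L) = (p : ℝ≥0)⁻¹) (hβ : β ^ (p - 1) = p) {y w : L}
    (hy : v y = β) (hw : v w ≤ 1) : v ((y + w) ^ p - y ^ p) ≤ 1 := by
  rw [add_pow, Finset.sum_range_succ]
  simp only [Nat.sub_self, pow_zero, mul_one, Nat.choose_self, Nat.cast_one, add_sub_cancel_right]
  refine v.map_sum_le fun k hk => ?_
  exact (val_binomial_term_le v hvp hβ hy (Finset.mem_range.1 hk)).trans
    (pow_le_one₀ zero_le hw)

theorem val_add_pow_sub_of_gt (hvp : v (p : L) = (p : ℝ≥0)⁻¹) (hβ : β ^ (p - 1) = p) {y w : L}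
    (hy : v y = β) (hw : 1 < v w) : v ((y + w) ^ p - y ^ p) = v w ^ p := by
  rw [add_pow, Finset.sum_range_succ]
  simp only [Nat.sub_self, pow_zero, mul_one, Nat.choose_self, Nat.cast_one, add_sub_cancel_right]
  obtain ⟨m, rfl⟩ : ∃ m, p = m + 1 := ⟨p - 1, by have := hp.out.two_le; omega⟩
  rw [Finset.sum_range_succ']
  simp only [pow_zero, one_mul, Nat.sub_zero, Nat.choose_zero_right, Nat.cast_one, mul_one]
  have hw0 : v w ≠ 0 := (zero_lt_one.trans hw).ne'
  have hsum : v (∑ k ∈ Finset.range m,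
      y ^ (k + 1) * w ^ (m + 1 - (k + 1)) * ((m + 1).choose (k + 1) : L)) < v (w ^ (m + 1)) := by
    rw [map_pow]
    refine v.map_sum_lt (pow_ne_zero _ hw0) fun k hk => ?_
    have hk := Finset.mem_range.1 hk
    refine (val_binomial_term_le v hvp hβ hy (by omega)).trans_lt ?_
    exact pow_lt_pow_right₀ hw (by omega)
  rw [v.map_add_eq_of_lt_right hsum, map_pow]

/-- The points at which `z ↦ z ^ p` takes values that are equal, or at distance one, are themselves
equal or at distance one: on the residue discs the map is separable. -/
theorem val_sub_eq_one_of_pow (hvp : v (p : L) = (p : ℝ≥0)⁻¹) (hβ : β ^ (p - 1) = p) {y z : L}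
    (hy : v y = β) (hzy : z ≠ y) (h : z ^ p = y ^ p ∨ v (z ^ p - y ^ p) = 1) : v (z - y) = 1 := by
  have h0 : v (z - y) ≠ 0 := v.ne_zero_iff.2 (sub_ne_zero.2 hzy)
  have hz : z = y + (z - y) := by ring
  have h' : v (z ^ p - y ^ p) = 0 ∨ v (z ^ p - y ^ p) = 1 := by
    rcases h with h | h
    · left; rw [h, sub_self, map_zero]
    · exact Or.inr h
  rcases lt_trichotomy (v (z - y)) 1 with hlt | heq | hgt
  · have := val_add_pow_sub_of_lt v hvp hβ hy hlt
    rw [← hz] at this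
    rw [this] at h'
    rcases h' with h' | h'
    · exact absurd h' h0
    · exact absurd h' hlt.ne
  · exact heq
  · have := val_add_pow_sub_of_gt v hvp hβ hy hgt
    rw [← hz] at this
    rw [this] at h'
    rcases h' with h' | h'
    · exact absurd h' (pow_ne_zero _ h0)
    · exact absurd h' (one_lt_pow₀ hgt hp.out.ne_zero).ne'

end ValuationArithmetic

/-! ### Preimage trees of `z ↦ z ^ p - c` -/

section Dynamics

variable {L : Type*} [Field L] (v : Valuation L ℝ≥0) {p : ℕ} [hp : Fact p.Prime] {β : ℝ≥0} {c : L}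

theorem val_root_eq (hc : v c = β ^ p) {y z : L} (hy : v y < β ^ p)
    (h : z ^ p - c = y) : v z = β := by
  have h1 : z ^ p = y + c := by rw [← h]; ring
  have h2 : v z ^ p = β ^ p := by
    rw [← map_pow, h1, v.map_add_eq_of_lt_right (by rwa [hc]), hc]
  exact (pow_left_inj₀ zero_le zero_le hp.out.ne_zero).1 h2

theorem lt_pow_self_of_prime (hβ : β ^ (p - 1) = p) : β < β ^ p := by
  have := one_lt_of_pow_pred_eq hβ
  calc β = β ^ 1 := (pow_one _).symm
    _ < β ^ p := pow_lt_pow_right₀ this hp.out.one_lt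

theorem val_iterate_root_lt (hβ : β ^ (p - 1) = p) (hc : v c = β ^ p) {y : L} (hy : v y < β ^ p)
    (m : ℕ) {z : L} (h : (fun x : L => x ^ p - c)^[m] z = y) : v z < β ^ p := by
  induction m generalizing z with
  | zero => simpa [← h] using hy
  | succ m ih =>
    rw [Function.iterate_succ_apply] at h
    rw [val_root_eq v hc (ih h) rfl]
    exact lt_pow_self_of_prime hβ

theorem val_iterate_root_eq (hβ : β ^ (p - 1) = p) (hc : v c = β ^ p) {y : L} (hy : v y < β ^ p)
    (m : ℕ) {z : L} (h : (fun x : L => x ^ p - c)^[m + 1] z = y) : v z = β := by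
  rw [Function.iterate_succ_apply] at h
  exact val_root_eq v hc (val_iterate_root_lt v hβ hc hy m h) rfl

/-- Distinct points of the tree of preimages of a point `y` with `v(y) > v(c)` that lie on the same
level differ by a unit. -/
theorem val_sub_eq_one_of_iterate (hvp : v (p : L) = (p : ℝ≥0)⁻¹) (hβ : β ^ (p - 1) = p)
    (hc : v c = β ^ p) {y : L} (hy : v y < β ^ p) (m : ℕ) {z z' : L}
    (h : (fun x : L => x ^ p - c)^[m] z = y) (h' : (fun x : L => x ^ p - c)^[m] z' = y)
    (hne : z ≠ z') : v (z - z') = 1 := by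
  induction m generalizing z z' with
  | zero => exact absurd (h.trans h'.symm) hne
  | succ m ih =>
    have hz := val_iterate_root_eq v hβ hc hy m h'
    rw [Function.iterate_succ_apply] at h h'
    refine val_sub_eq_one_of_pow v hvp hβ hz hne ?_
    by_cases heq : z ^ p - c = z' ^ p - c
    · left; exact sub_left_injective heq
    · right
      have := ih h h' heq
      rwa [sub_sub_sub_cancel_right] at this

theorem exists_root [IsAlgClosed L] (c y : L) : ∃ z : L, z ^ p - c = y := by
  obtain ⟨z, hz⟩ := IsAlgClosed.exists_pow_nat_eq (y + c) hp.out.pos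
  exact ⟨z, by rw [hz]; ring⟩

theorem exists_iterate_root [IsAlgClosed L] (c y : L) (n : ℕ) :
    ∃ z : L, (fun x : L => x ^ p - c)^[n] z = y := by
  have : Function.Surjective (fun x : L => x ^ p - c) := exists_root c
  exact this.iterate n y

/-- Far enough up the tree of preimages of any point there are points `z` with `v(z) > v(c)`: as
long as `v(z) ≤ v(c)`, the absolute value drops at least to its `p`-th root at each step. -/
theorem exists_iterate_root_lt [IsAlgClosed L] (hβ : β ^ (p - 1) = p) (hc : v c = β ^ p) (a : L) :
    ∃ n z, (fun x : L => x ^ p - c)^[n] z = a ∧ v z < β ^ p := by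
  by_contra! hcon
  have hβ1 := one_lt_of_pow_pred_eq hβ
  have key : ∀ n z, (fun x : L => x ^ p - c)^[n] z = a → v z ^ p ^ n ≤ v a := by
    intro n
    induction n with
    | zero => intro z hz; simp [← hz]
    | succ n ih =>
      intro z hz
      have hz' := hz
      rw [Function.iterate_succ_apply] at hz
      have h1 := ih _ hz
      have h2 := hcon _ _ hz
      have h3 : v z ^ p ≤ v (z ^ p - c) := by
        rw [← map_pow]
        calc v (z ^ p) = v ((z ^ p - c) + c) := by rw [sub_add_cancel]
          _ ≤ max (v (z ^ p - c)) (v c) := v.map_add _ _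
          _ ≤ v (z ^ p - c) := max_le le_rfl (hc ▸ h2)
      calc v z ^ p ^ (n + 1) = (v z ^ p) ^ p ^ n := by rw [pow_succ', pow_mul]
        _ ≤ _ := pow_le_pow_left₀ zero_le h3 _
        _ ≤ _ := h1
  obtain ⟨n, hn⟩ := pow_unbounded_of_one_lt (v a) hβ1
  obtain ⟨z, hz⟩ := exists_iterate_root (p := p) c a n
  have h1 := key n z hz
  have h2 := hcon n z hz
  refine absurd (hn.trans_le ?_) (not_lt.2 h1)
  calc β ^ n ≤ β ^ p ^ n := pow_le_pow_right₀ hβ1.le (Nat.lt_pow_self hp.out.one_lt).le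
    _ ≤ v z ^ p ^ n := pow_le_pow_left₀ zero_le ((lt_pow_self_of_prime hβ).le.trans h2) _

/-- Above a point with `v(y) > v(c)` the levels of the tree grow at least like powers of two. -/
theorem exists_finset_iterate_root [IsAlgClosed L] [CharZero L] (hβ : β ^ (p - 1) = p)
    (hc : v c = β ^ p) {y : L} (hy : v y < β ^ p) (m : ℕ) :
    ∃ S : Finset L, S.card = 2 ^ m ∧ ∀ z ∈ S, (fun x : L => x ^ p - c)^[m] z = y := by
  classical
  induction m with
  | zero => exact ⟨{y}, by simp, by simp⟩
  | succ m ih =>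
    obtain ⟨S, hS, hSm⟩ := ih
    choose r hr using fun t : L => exists_root (p := p) c t
    have : NeZero (p : L) := ⟨by exact_mod_cast hp.out.ne_zero⟩
    obtain ⟨ζ, hζ⟩ := HasEnoughRootsOfUnity.exists_primitiveRoot L p
    have hrinj : Function.Injective r := fun s t h => by rw [← hr s, ← hr t, h]
    have hζr : ∀ t, (ζ * r t) ^ p - c = t := fun t => by
      rw [mul_pow, hζ.pow_eq_one, one_mul, hr]
    have hζinj : Function.Injective (fun t => ζ * r t) := fun s t h => by
      rw [← hζr s, ← hζr t]; exact congrArg (fun x => x ^ p - c) h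
    -- two of the `p` points over each point of the previous level
    refine ⟨S.image r ∪ S.image (fun t => ζ * r t), ?_, ?_⟩
    · rw [Finset.card_union_of_disjoint, Finset.card_image_of_injective _ hrinj,
        Finset.card_image_of_injective _ hζinj, hS, pow_succ, mul_two]
      rw [Finset.disjoint_left]
      intro x hx hx'
      obtain ⟨s, hs, rfl⟩ := Finset.mem_image.1 hx
      obtain ⟨t, ht, hst⟩ := Finset.mem_image.1 hx'
      have hts : t = s := by
        rw [← hζr t, ← hr s]; exact congrArg (fun x => x ^ p - c) hst
      subst hts
      have h1 : v (r t) = β :=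
        val_root_eq v hc (val_iterate_root_lt v hβ hc hy m (hSm t ht)) (hr t)
      have h2 : r t ≠ 0 := by
        rw [← v.ne_zero_iff, h1]
        exact (zero_lt_one.trans (one_lt_of_pow_pred_eq hβ)).ne'
      exact hζ.ne_one hp.out.one_lt (mul_right_cancel₀ h2 (by simpa using hst))
    · intro z hz
      rw [Function.iterate_succ_apply]
      rcases Finset.mem_union.1 hz with hz | hz
      · obtain ⟨s, hs, rfl⟩ := Finset.mem_image.1 hz
        simpa only [hr] using hSm s hs
      · obtain ⟨s, hs, rfl⟩ := Finset.mem_image.1 hz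
        simpa only [hζr] using hSm s hs

theorem val_fixedPoint (hβ : β ^ (p - 1) = p) (hc : v c = β ^ p) {b : L} (hb : b ^ p - c = b) :
    v b = β := by
  refine val_root_eq v hc ?_ hb
  by_contra! h
  have hβ1 := one_lt_of_pow_pred_eq hβ
  have hb1 : 1 < v b := (hβ1.trans (lt_pow_self_of_prime hβ)).trans_le h
  have h1 : v b < v (b ^ p) := by
    rw [map_pow]
    calc v b = v b ^ 1 := (pow_one _).symm
      _ < v b ^ p := pow_lt_pow_right₀ hb1 hp.out.one_lt
  have h2 : v c = v b ^ p := by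
    rw [← map_pow, ← v.map_sub_eq_of_lt_left h1]
    congr 1
    linear_combination -hb
  rw [hc] at h2
  have h3 : β = v b := (pow_left_inj₀ zero_le zero_le hp.out.ne_zero).1 h2
  exact absurd (h3 ▸ h) (not_le.2 (lt_pow_self_of_prime hβ))

/-- The preimages of the unit disc around the fixed point lie in that disc. -/
theorem val_sub_fixedPoint_le_one (hvp : v (p : L) = (p : ℝ≥0)⁻¹) (hβ : β ^ (p - 1) = p)
    (hc : v c = β ^ p) {a b : L} (hb : b ^ p - c = b) (hab : v (a - b) ≤ 1) (m : ℕ) {z : L}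
    (h : (fun x : L => x ^ p - c)^[m] z = a) : v (z - b) ≤ 1 := by
  induction m generalizing z with
  | zero => simpa [← h] using hab
  | succ m ih =>
    rw [Function.iterate_succ_apply] at h
    by_contra! hgt
    have h1 := val_add_pow_sub_of_gt v hvp hβ (val_fixedPoint v hβ hc hb) hgt
    have h2 := ih h
    have h3 : z ^ p - c - b = (b + (z - b)) ^ p - b ^ p := by
      rw [add_sub_cancel]; linear_combination hb
    rw [h3, h1] at h2
    exact absurd (one_lt_pow₀ hgt hp.out.ne_zero) (not_lt.2 h2)

/-- Outside the unit disc around the fixed point, the map raises the distance from the fixed point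
to the `p`-th power. -/
theorem val_sub_fixedPoint_pow (hvp : v (p : L) = (p : ℝ≥0)⁻¹) (hβ : β ^ (p - 1) = p)
    (hc : v c = β ^ p) {a b : L} (hb : b ^ p - c = b) (hab : 1 < v (a - b)) (m : ℕ) {z : L}
    (h : (fun x : L => x ^ p - c)^[m] z = a) : v (z - b) ^ p ^ m = v (a - b) := by
  induction m generalizing z with
  | zero => simp [← h]
  | succ m ih =>
    rw [Function.iterate_succ_apply] at h
    have hvb := val_fixedPoint v hβ hc hb
    have h2 := ih h
    have h3 : z ^ p - c - b = (b + (z - b)) ^ p - b ^ p := by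
      rw [add_sub_cancel]; linear_combination hb
    have hgt : 1 < v (z - b) := by
      by_contra! hle
      have h4 := val_add_pow_sub_le_one v hvp hβ hvb hle
      rw [← h3] at h4
      rw [← h2] at hab
      exact absurd hab (not_lt.2 (pow_le_one₀ zero_le h4))
    rw [← h2, h3, val_add_pow_sub_of_gt v hvp hβ hvb hgt, pow_succ', pow_mul]

/-- Consecutive points of a branch over a point outside the unit disc around the fixed point have
a difference whose absolute value is a root of arbitrarily high `p`-power order. -/
theorem val_sub_iterate_pow (hvp : v (p : L) = (p : ℝ≥0)⁻¹) (hβ : β ^ (p - 1) = p)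
    (hc : v c = β ^ p) {a b : L} (hb : b ^ p - c = b) (hab : 1 < v (a - b)) (m : ℕ) {z : L}
    (h : (fun x : L => x ^ p - c)^[m + 1] z = a) : v (z ^ p - c - z) ^ p ^ m = v (a - b) := by
  have h1 := val_sub_fixedPoint_pow v hvp hβ hc hb hab _ h
  rw [Function.iterate_succ_apply] at h
  have h2 := val_sub_fixedPoint_pow v hvp hβ hc hb hab _ h
  have hlt : v (z - b) < v (z ^ p - c - b) := by
    have hgt : 1 < v (z - b) := by
      by_contra! hle
      rw [← h1] at hab
      exact absurd hab (not_lt.2 (pow_le_one₀ zero_le hle))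
    have h3 : v (z - b) ^ p = v (z ^ p - c - b) := by
      refine (pow_left_inj₀ zero_le zero_le (pow_ne_zero m hp.out.ne_zero)).1 ?_
      rw [h2, ← h1, ← pow_mul, ← pow_succ']
    rw [← h3]
    calc v (z - b) = v (z - b) ^ 1 := (pow_one _).symm
      _ < v (z - b) ^ p := pow_lt_pow_right₀ hgt hp.out.one_lt
  rw [← h2, ← v.map_sub_eq_of_lt_left hlt, sub_sub_sub_cancel_right]

end Dynamics

/-! ### Invariant lifts and values under groups acting by isometries -/

section Congruences

variable {E : Type*} [Field E] (v : Valuation E ℝ≥0)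

theorem residue_eq_residue_iff (x y : v.valuationSubring) :
    IsLocalRing.residue v.valuationSubring x = IsLocalRing.residue v.valuationSubring y ↔
      v ((x : E) - y) < 1 := by
  rw [← sub_eq_zero, ← map_sub, IsLocalRing.residue_eq_zero_iff, Valuation.mem_maximalIdeal_iff]
  rfl

theorem val_prod_sub_pow_lt_one {ι : Type*} (s : Finset ι) {f : ι → E} {x : E} (hx : v x ≤ 1)
    (hf : ∀ i ∈ s, v (f i - x) < 1) : v (∏ i ∈ s, f i - x ^ s.card) < 1 := by
  classical
  induction s using Finset.induction_on with
  | empty => simp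
  | insert i s hi ih =>
    have h1 := ih fun j hj => hf j (Finset.mem_insert_of_mem hj)
    have h2 := hf i (Finset.mem_insert_self i s)
    have h3 : v (f i) ≤ 1 := by
      rw [← sub_add_cancel (f i) x]
      exact v.map_add_le h2.le hx
    rw [Finset.prod_insert hi, Finset.card_insert_of_notMem hi, pow_succ]
    have h4 : f i * ∏ j ∈ s, f j - x ^ s.card * x =
        f i * (∏ j ∈ s, f j - x ^ s.card) + (f i - x) * x ^ s.card := by ring
    rw [h4]
    refine v.map_add_lt ?_ ?_
    · rw [map_mul]; exact mul_lt_one_of_nonneg_of_lt_one_right h3 zero_le h1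
    · rw [map_mul]
      refine mul_lt_one_of_nonneg_of_lt_one_left zero_le h2 ?_
      rw [map_pow]; exact pow_le_one₀ zero_le hx

theorem val_pow_sub_pow_lt_one {x y : E} (hy : v y ≤ 1) (h : v (x - y) < 1) (n : ℕ) :
    v (x ^ n - y ^ n) < 1 := by
  have := val_prod_sub_pow_lt_one v (Finset.range n) (f := fun _ => x) hy fun _ _ => h
  simpa using this

theorem val_sub_lt_one_trans {x y z : E} (h : v (x - y) < 1) (h' : v (y - z) < 1) :
    v (x - z) < 1 := by
  rw [← sub_add_sub_cancel x y z]
  exact v.map_add_lt h h'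

theorem val_pow_pow_sub_lt_one {x : E} (hx : v x ≤ 1) {q : ℕ} (hq : v (x ^ q - x) < 1) (n : ℕ) :
    v (x ^ q ^ n - x) < 1 := by
  induction n with
  | zero => simp
  | succ n ih =>
    rw [pow_succ, pow_mul]
    exact val_sub_lt_one_trans v (val_pow_sub_pow_lt_one v hx ih q) hq

end Congruences

section Actions

variable {E : Type*} [Field E] {v : Valuation E ℝ≥0} {H : Type*} [Group H] [MulSemiringAction H E]

/-- An integral element `x` whose residue class is algebraic over `𝔽_p` and fixed by `H`, and whose
orbit has `p ^ k` elements, is congruent to an integral element fixed by `H`. The product over the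
orbit is invariant and congruent to `x ^ p ^ k`; raising it to the power `p ^ (j * k - k)` gives an
element congruent to `x ^ p ^ (j * k)`, that is, to `x`. -/
theorem exists_invariant_lift {x : E} (hx : v x ≤ 1) (hfix : ∀ σ : H, v (σ • x - x) < 1)
    {p k j : ℕ} (hp : p ≠ 0) (hj : 1 ≤ j) (hcard : Nat.card (MulAction.orbit H x) = p ^ k)
    (hpow : v (x ^ p ^ j - x) < 1) :
    ∃ y, v y ≤ 1 ∧ (∀ σ : H, σ • y = y) ∧ v (y - x) < 1 := by
  have : Finite (MulAction.orbit H x) :=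
    Nat.finite_of_card_ne_zero (by rw [hcard]; exact pow_ne_zero _ hp)
  have := Fintype.ofFinite (MulAction.orbit H x)
  have horb : ∀ z : MulAction.orbit H x, v ((z : E) - x) < 1 := by
    rintro ⟨_, σ, rfl⟩
    exact hfix σ
  set N : E := ∏ z : MulAction.orbit H x, (z : E) with hN
  have hinv : ∀ σ : H, σ • N = N := by
    intro σ
    rw [hN, Finset.smul_prod']
    exact Equiv.prod_comp (MulAction.toPerm σ : Equiv.Perm (MulAction.orbit H x))
      (fun z => (z : E))
  have hNx : v (N - x ^ p ^ k) < 1 := by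
    have := val_prod_sub_pow_lt_one v Finset.univ hx fun z _ => horb z
    rwa [Finset.card_univ, ← Nat.card_eq_fintype_card, hcard] at this
  have hxk : v (x ^ p ^ k) ≤ 1 := by rw [map_pow]; exact pow_le_one₀ zero_le hx
  have hyx : v (N ^ p ^ (j * k - k) - x) < 1 := by
    refine val_sub_lt_one_trans v (val_pow_sub_pow_lt_one v hxk hNx _) ?_
    have h1 : k + (j * k - k) = j * k := by
      have := Nat.le_mul_of_pos_left k hj
      omega
    rw [← pow_mul, ← pow_add, h1, pow_mul]
    exact val_pow_pow_sub_lt_one v hx hpow k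
  refine ⟨N ^ p ^ (j * k - k), ?_, fun σ => by rw [smul_pow', hinv], hyx⟩
  rw [← sub_add_cancel (N ^ p ^ (j * k - k)) x]
  exact v.map_add_le hyx.le hx

/-- If `V` consists of all elements that act trivially on the residue field of the fixed field of
`V`, then the fixed fields of `V` and of the whole group have the same values: since the residue
characters of `H ⧸ V` are distinct, Dedekind's independence of characters yields an integral `y`
for which the trace `∑ τ (π y)` over `H ⧸ V` has the same value as `π`. -/
theorem exists_invariant_val_eq (hiso : ∀ (σ : H) (x : E), v (σ • x) = v x) (V : Subgroup H)
    [V.FiniteIndex] {π : E} (hπ : π ≠ 0) (hVπ : ∀ σ ∈ V, σ • π = π)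
    (hfaith : ∀ σ : H, (∀ y, v y ≤ 1 → (∀ τ ∈ V, τ • y = y) → v (σ • y - y) < 1) → σ ∈ V) :
    ∃ Y, v Y = v π ∧ ∀ σ : H, σ • Y = Y := by
  have := Fintype.ofFinite (H ⧸ V)
  let B : Submonoid E :=
    { carrier := {y | v y ≤ 1 ∧ ∀ τ ∈ V, τ • y = y}
      one_mem' := ⟨v.map_one.le, fun τ _ => smul_one τ⟩
      mul_mem' := by
        rintro x y ⟨hx, hx'⟩ ⟨hy, hy'⟩
        refine ⟨?_, fun τ hτ => by rw [smul_mul', hx' τ hτ, hy' τ hτ]⟩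
        rw [map_mul]; exact mul_le_one' hx hy }
  have hout : ∀ (y : E), (∀ τ ∈ V, τ • y = y) → ∀ σ : H, (QuotientGroup.mk σ : H ⧸ V).out • y =
      σ • y := by
    intro y hy σ
    have h1 : σ⁻¹ * (QuotientGroup.mk σ : H ⧸ V).out ∈ V :=
      QuotientGroup.eq.1 (QuotientGroup.out_eq' _).symm
    have h2 := hy _ h1
    rw [mul_smul, inv_smul_eq_iff] at h2
    exact h2
  -- the residue classes of the conjugates, as characters of the monoid of `V`-invariant integers
  let χ : H ⧸ V → B →* IsLocalRing.ResidueField v.valuationSubring := fun q =>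
    { toFun := fun y => IsLocalRing.residue v.valuationSubring
        ⟨q.out • (y : E), by rw [Valuation.mem_valuationSubring_iff, hiso]; exact y.2.1⟩
      map_one' := by
        rw [← map_one (IsLocalRing.residue v.valuationSubring)]
        congr 1
        exact Subtype.ext (smul_one _)
      map_mul' := fun x y => by
        rw [← map_mul (IsLocalRing.residue v.valuationSubring)]
        congr 1
        exact Subtype.ext (smul_mul' _ _ _) }
  have hχ : Function.Injective χ := by
    intro q q' h
    rw [← QuotientGroup.out_eq' q, ← QuotientGroup.out_eq' q', QuotientGroup.eq]
    apply hfaith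
    intro y hy hy'
    have h1 := DFunLike.congr_fun h.symm ⟨y, hy, hy'⟩
    have h2 := (residue_eq_residue_iff v _ _).1 h1
    rw [← hiso q.out, smul_sub, smul_smul, mul_inv_cancel_left]
    exact h2
  have hli := (linearIndependent_monoidHom B (IsLocalRing.ResidueField v.valuationSubring)).comp
    χ hχ
  rw [Fintype.linearIndependent_iff] at hli
  have hvπ : v π ≠ 0 := v.ne_zero_iff.2 hπ
  have hu : ∀ q : H ⧸ V, v (q.out • π / π) = 1 := fun q => by
    rw [map_div₀, hiso, div_self hvπ]
  let u : H ⧸ V → v.valuationSubring := fun q =>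
    ⟨q.out • π / π, (v.mem_valuationSubring_iff _).2 (hu q).le⟩
  have hex : ∃ y : B, ∑ q : H ⧸ V, IsLocalRing.residue v.valuationSubring (u q) * χ q y ≠ 0 := by
    by_contra! hall
    have h1 := hli (fun q => IsLocalRing.residue v.valuationSubring (u q))
      (by ext y; simpa using hall y) (QuotientGroup.mk 1)
    rw [IsLocalRing.residue_eq_zero_iff, Valuation.mem_maximalIdeal_iff] at h1
    exact absurd (hu _) h1.ne
  obtain ⟨⟨y, hy, hy'⟩, hne⟩ := hex
  have hfixed : ∀ τ ∈ V, τ • (π * y) = π * y := fun τ hτ => by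
    rw [smul_mul', hVπ τ hτ, hy' τ hτ]
  refine ⟨∑ q : H ⧸ V, q.out • (π * y), ?_, ?_⟩
  · let w : v.valuationSubring := ∑ q : H ⧸ V, u q *
      ⟨q.out • y, by rw [Valuation.mem_valuationSubring_iff, hiso]; exact hy⟩
    have hw : IsLocalRing.residue v.valuationSubring w ≠ 0 := by
      rw [map_sum]
      simp only [map_mul]
      exact hne
    have hw1 : v (w : E) = 1 := by
      rw [Ne, IsLocalRing.residue_eq_zero_iff, Valuation.mem_maximalIdeal_iff, not_lt] at hw
      exact le_antisymm w.2 hw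
    have hYw : ∑ q : H ⧸ V, q.out • (π * y) = π * (w : E) := by
      rw [AddSubmonoidClass.coe_finsetSum, Finset.mul_sum]
      refine Finset.sum_congr rfl fun q _ => ?_
      change _ = π * (q.out • π / π * q.out • y)
      rw [smul_mul']
      field_simp
    rw [hYw, map_mul, hw1, mul_one]
  · intro σ
    refine Eq.trans ?_ (Equiv.sum_comp (MulAction.toPerm σ : Equiv.Perm (H ⧸ V)) _)
    rw [Finset.smul_sum]
    refine Finset.sum_congr rfl fun q _ => ?_
    rw [smul_smul, ← hout _ hfixed]
    congr 2
    rw [MulAction.toPerm_apply]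
    conv_rhs => rw [← QuotientGroup.out_eq' q]
    rfl

end Actions

/-- A group acting on an algebraic field over `𝔽_p` acts on any finite set through powers of one
element, because the automorphism groups of finite fields are cyclic. -/
theorem exists_generator_mod_stabilizer (p : ℕ) [Fact p.Prime] {k H : Type*} [Field k]
    [Algebra (ZMod p) k] [Algebra.IsAlgebraic (ZMod p) k] [Group H] [MulSemiringAction H k]
    (X : Set k) (hX : X.Finite) : ∃ γ : H, ∀ δ : H, ∃ i : ℤ, ∀ x ∈ X, (δ * γ ^ i) • x = x := by
  have hcomm : SMulCommClass H (ZMod p) k := ⟨fun g r x => by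
    rw [Algebra.smul_def, Algebra.smul_def, smul_mul']
    congr 1
    exact DFunLike.congr_fun (Subsingleton.elim
      ((MulSemiringAction.toRingHom H k g).comp (algebraMap (ZMod p) k))
      (algebraMap (ZMod p) k)) r⟩
  let F := IntermediateField.adjoin (ZMod p) X
  have : Finite X := hX
  have hfin : FiniteDimensional (ZMod p) F :=
    IntermediateField.finiteDimensional_adjoin fun x _ => Algebra.IsIntegral.isIntegral x
  have : Finite F := Module.finite_of_finite (ZMod p)
  let φ : H →* Gal(F/ZMod p) := (AlgEquiv.restrictNormalHom F).comp
    (MulSemiringAction.toAlgAut H (ZMod p) k)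
  obtain ⟨⟨_, γ, rfl⟩, hγ⟩ := IsCyclic.exists_generator (α := φ.range)
  refine ⟨γ, fun δ => ?_⟩
  obtain ⟨i, hi⟩ := Subgroup.mem_zpowers_iff.1 (hγ ⟨φ δ, δ, rfl⟩)
  refine ⟨-i, fun x hx => ?_⟩
  have h1 : φ (δ * γ ^ (-i)) = 1 := by
    have := congrArg Subtype.val hi
    rw [SubgroupClass.coe_zpow] at this
    rw [map_mul, map_zpow, zpow_neg, mul_inv_eq_one]
    exact this.symm
  have hxF : x ∈ F := IntermediateField.subset_adjoin _ _ hx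
  have h2 := AlgEquiv.restrictNormal_commutes
    (MulSemiringAction.toAlgAut H (ZMod p) k (δ * γ ^ (-i))) F ⟨x, hxF⟩
  have h3 : AlgEquiv.restrictNormal
    (MulSemiringAction.toAlgAut H (ZMod p) k (δ * γ ^ (-i))) F = 1 := h1
  rw [h3] at h2
  exact h2.symm

/-! ### Profinite groups with cyclic finite quotients -/

section ProfiniteGroups

theorem nonempty_continuousMulEquiv_of_bijective {G H : Type*} [Group G] [TopologicalSpace G]
    [CompactSpace G] [Group H] [TopologicalSpace H] [T2Space H] (f : G →* H) (hf : Continuous f)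
    (hbij : Function.Bijective f) : Nonempty (G ≃ₜ* H) := by
  let e : G ≃* H := MulEquiv.ofBijective f hbij
  have h1 : Continuous e.toEquiv.symm :=
    Continuous.continuous_symm_of_equiv_compact_to_t2 (f := e.toEquiv) hf
  exact ⟨{ e with continuous_toFun := hf, continuous_invFun := h1 }⟩

variable {Γ : Type*} [Group Γ]

/-- If `Γ/N` is a finite cyclic `p`-group generated by `g`, and `N ≤ N₀ ≠ Γ`, then every generator
of `Γ/N₀` generates `Γ/N`: the quotient `Γ/N₀` sees the Frattini quotient of `Γ/N`. -/
theorem generates_of_generates_quotient (p : ℕ) [hp : Fact p.Prime] {N N₀ : Subgroup Γ}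
    [N.Normal] [N₀.Normal] (hle : N ≤ N₀) (htop : N₀ ≠ ⊤) {g γ : Γ}
    (hg : ∀ δ, ∃ i : ℤ, δ * g ^ i ∈ N) (hpow : ∀ δ : Γ, ∃ k : ℕ, δ ^ p ^ k ∈ N)
    (hγ : ∀ δ, ∃ i : ℤ, δ * γ ^ i ∈ N₀) (δ : Γ) : ∃ i : ℤ, δ * γ ^ i ∈ N := by
  have hmk : ∀ (M : Subgroup Γ) [M.Normal] (x y : Γ) (i : ℤ), x * y ^ i ∈ M →
      (QuotientGroup.mk x : Γ ⧸ M) = (QuotientGroup.mk y : Γ ⧸ M) ^ (-i) := by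
    intro M _ x y i h
    have := (QuotientGroup.eq_one_iff (N := M) _).2 h
    rw [QuotientGroup.mk_mul, QuotientGroup.mk_zpow] at this
    rw [zpow_neg]
    exact eq_inv_of_mul_eq_one_left this
  obtain ⟨i, hi⟩ := hg γ
  obtain ⟨k, hk⟩ := hpow g
  by_cases hpi : (p : ℤ) ∣ i
  · exfalso
    obtain ⟨j, rfl⟩ := hpi
    obtain ⟨l, hl⟩ := hγ g
    obtain ⟨m, hm⟩ := hpow γ
    have h1 := hmk N₀ _ _ _ (hle hi)
    have h2 := hmk N₀ _ _ _ hl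
    have h3 : (QuotientGroup.mk γ : Γ ⧸ N₀) ^ ((p : ℤ) ^ m) = 1 := by
      have := (QuotientGroup.eq_one_iff (N := N₀) _).2 (hle hm)
      rw [QuotientGroup.mk_pow] at this
      exact_mod_cast this
    rw [h2, ← zpow_mul] at h1
    have h4 : (QuotientGroup.mk γ : Γ ⧸ N₀) ^ (1 - (p : ℤ) * (l * j)) = 1 := by
      rw [zpow_sub, zpow_one, mul_inv_eq_one]
      convert h1 using 2
      ring
    have hcop : IsCoprime (1 - (p : ℤ) * (l * j)) ((p : ℤ) ^ m) :=
      IsCoprime.pow_right ⟨1, l * j, by ring⟩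
    obtain ⟨u, w, huw⟩ := hcop
    have h5 : (QuotientGroup.mk γ : Γ ⧸ N₀) = 1 := by
      rw [← zpow_one (QuotientGroup.mk γ : Γ ⧸ N₀), ← huw, zpow_add, mul_comm u, mul_comm w,
        zpow_mul, zpow_mul, h4, h3, one_zpow, one_zpow, one_mul]
    apply htop
    rw [eq_top_iff]
    intro x _
    obtain ⟨n, hn⟩ := hγ x
    have h6 := hmk N₀ _ _ _ hn
    rw [h5, one_zpow] at h6
    exact (QuotientGroup.eq_one_iff (N := N₀) _).1 h6
  · have hcop : IsCoprime i ((p : ℤ) ^ k) := by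
      refine IsCoprime.pow_right (IsCoprime.symm ?_)
      exact (Prime.coprime_iff_not_dvd (Nat.prime_iff_prime_int.1 hp.out)).2 hpi
    obtain ⟨u, w, huw⟩ := hcop
    have h1 := hmk N _ _ _ hi
    have h2 : (QuotientGroup.mk g : Γ ⧸ N) ^ ((p : ℤ) ^ k) = 1 := by
      have := (QuotientGroup.eq_one_iff (N := N) _).2 hk
      rw [QuotientGroup.mk_pow] at this
      exact_mod_cast this
    have h3 : (QuotientGroup.mk g : Γ ⧸ N) = (QuotientGroup.mk γ : Γ ⧸ N) ^ (-u) := by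
      have h4 : (QuotientGroup.mk g : Γ ⧸ N) = (QuotientGroup.mk g : Γ ⧸ N) ^ (i * u) := by
        conv_lhs => rw [← zpow_one (QuotientGroup.mk g : Γ ⧸ N), ← huw, zpow_add, mul_comm w,
          zpow_mul _ _ w, h2, one_zpow, mul_one, mul_comm]
      rw [h1, ← zpow_mul, neg_mul_neg]
      exact h4
    obtain ⟨n, hn⟩ := hg δ
    have h5 := hmk N _ _ _ hn
    rw [h3, ← zpow_mul] at h5
    refine ⟨-(-u * -n), ?_⟩
    rw [← QuotientGroup.eq_one_iff (N := N), QuotientGroup.mk_mul, QuotientGroup.mk_zpow, h5,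
      ← zpow_add, add_neg_cancel, zpow_zero]

variable [TopologicalSpace Γ] [IsTopologicalGroup Γ] [CompactSpace Γ]
  [TotallyDisconnectedSpace Γ]

theorem exists_open_normal_notMem {x : Γ} (hx : x ≠ 1) :
    ∃ N : Subgroup Γ, N.Normal ∧ IsOpen (N : Set Γ) ∧ x ∉ N := by
  obtain ⟨N, hN⟩ := ProfiniteGrp.exist_openNormalSubgroup_sub_open_nhds_of_one
    (isOpen_compl_singleton (x := x)) (by simpa using hx.symm)
  exact ⟨N.toSubgroup, N.isNormal', N.isOpen', fun h => hN h rfl⟩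

theorem exists_topological_generator (p : ℕ) [Fact p.Prime]
    (hcyc : ∀ N : Subgroup Γ, N.Normal → IsOpen (N : Set Γ) → ∃ γ, ∀ δ, ∃ i : ℤ, δ * γ ^ i ∈ N)
    (hpow : ∀ N : Subgroup Γ, N.Normal → IsOpen (N : Set Γ) → ∀ δ : Γ, ∃ k : ℕ, δ ^ p ^ k ∈ N) :
    ∃ γ : Γ, ∀ N : Subgroup Γ, N.Normal → IsOpen (N : Set Γ) → ∀ δ, ∃ i : ℤ, δ * γ ^ i ∈ N := by
  by_cases htriv : ∀ x : Γ, x = 1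
  · exact ⟨1, fun N _ _ δ => ⟨0, by rw [htriv (δ * 1 ^ (0 : ℤ))]; exact N.one_mem⟩⟩
  push Not at htriv
  obtain ⟨x, hx⟩ := htriv
  -- A generator of one nontrivial finite quotient generates all of them.
  obtain ⟨N₀, hN₀, hN₀o, hxN₀⟩ := exists_open_normal_notMem hx
  obtain ⟨γ, hγ⟩ := hcyc N₀ hN₀ hN₀o
  refine ⟨γ, fun N hN hNo δ => ?_⟩
  have hn : (N ⊓ N₀).Normal := inferInstance
  have ho : IsOpen ((N ⊓ N₀ : Subgroup Γ) : Set Γ) := hNo.inter hN₀o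
  obtain ⟨g, hg⟩ := hcyc _ hn ho
  obtain ⟨i, hi⟩ := generates_of_generates_quotient p (N := N ⊓ N₀) (N₀ := N₀) inf_le_right
    (fun h => hxN₀ (h ▸ Subgroup.mem_top x)) hg (hpow _ hn ho) hγ δ
  exact ⟨i, hi.1⟩

/-- An infinite profinite group all of whose finite quotients are cyclic `p`-groups is isomorphic
to `ℤ_p`. If `γ` is a topological generator, then the closure of the subgroup generated
by `(γ, 1)` in `Γ × ℤ_p` is the graph of an isomorphism. -/
theorem nonempty_continuousMulEquiv_padicInt (p : ℕ) [hp : Fact p.Prime] [T2Space Γ]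
    [Infinite Γ]
    (hcyc : ∀ N : Subgroup Γ, N.Normal → IsOpen (N : Set Γ) → ∃ γ, ∀ δ, ∃ i : ℤ, δ * γ ^ i ∈ N)
    (hpow : ∀ N : Subgroup Γ, N.Normal → IsOpen (N : Set Γ) → ∀ δ : Γ, ∃ k : ℕ, δ ^ p ^ k ∈ N) :
    Nonempty (Γ ≃ₜ* Multiplicative ℤ_[p]) := by
  obtain ⟨γ, hγ⟩ := exists_topological_generator p hcyc hpow
  let D : Subgroup (Γ × Multiplicative ℤ_[p]) :=
    (Subgroup.zpowers (γ, Multiplicative.ofAdd (1 : ℤ_[p]))).topologicalClosure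
  have hDcl : IsClosed (D : Set (Γ × Multiplicative ℤ_[p])) :=
    Subgroup.isClosed_topologicalClosure _
  have hDc : CompactSpace D := isCompact_iff_compactSpace.1 hDcl.isCompact
  have hmem : ∀ n : ℤ, (γ ^ n, Multiplicative.ofAdd (n : ℤ_[p])) ∈ D := by
    intro n
    apply Subgroup.le_topologicalClosure
    refine ⟨n, ?_⟩
    simp only [Prod.pow_mk, ← ofAdd_zsmul, zsmul_one]
  have hclosure : ∀ S : Set (Γ × Multiplicative ℤ_[p]), IsClosed S →
      (∀ n : ℤ, (γ ^ n, Multiplicative.ofAdd (n : ℤ_[p])) ∈ S) → ∀ x ∈ D, x ∈ S := by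
    intro S hS hnS x hx
    refine closure_minimal ?_ hS hx
    rintro _ ⟨n, rfl⟩
    have := hnS n
    simpa only [Prod.pow_mk, ← ofAdd_zsmul, zsmul_one] using this
  let π₁ : D →* Γ := (MonoidHom.fst _ _).comp D.subtype
  let π₂ : D →* Multiplicative ℤ_[p] := (MonoidHom.snd _ _).comp D.subtype
  have hπ₁ : Continuous π₁ := continuous_fst.comp continuous_subtype_val
  have hπ₂ : Continuous π₂ := continuous_snd.comp continuous_subtype_val
  have hs₁ : Function.Surjective π₁ := by
    have hcl : IsClosed (Set.range π₁) := (isCompact_range hπ₁).isClosed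
    intro δ
    by_contra hδ
    have hδ' : δ ∈ (Set.range π₁)ᶜ := hδ
    obtain ⟨N, hN⟩ := ProfiniteGrp.exist_openNormalSubgroup_sub_open_nhds_of_one
      (U := (fun x => δ * x) ⁻¹' (Set.range π₁)ᶜ)
      (hcl.isOpen_compl.preimage (continuous_const_mul δ)) (by simpa using hδ')
    obtain ⟨i, hi⟩ := hγ N.toSubgroup N.isNormal' N.isOpen' δ⁻¹
    refine hN hi ⟨⟨_, hmem i⟩, ?_⟩
    change γ ^ i = δ * (δ⁻¹ * γ ^ i)
    rw [mul_inv_cancel_left]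
  have hs₂ : Function.Surjective π₂ := by
    have hcl : IsClosed (Set.range π₂) := (isCompact_range hπ₂).isClosed
    intro t
    induction t using Multiplicative.rec with
    | ofAdd t =>
      refine PadicInt.denseRange_intCast.induction_on (p := fun t : ℤ_[p] =>
        Multiplicative.ofAdd t ∈ Set.range π₂) t (hcl.preimage continuous_ofAdd) fun n => ?_
      exact ⟨⟨_, hmem n⟩, rfl⟩
  have hp0 : (p : ℝ) ≠ 0 := by exact_mod_cast hp.out.ne_zero
  -- The fibre over `0` is trivial: if `p ^ k ∣ n`, then `γ ^ n` lies in a prescribed open `N`.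
  have hi₂ : ∀ x : Γ, (x, Multiplicative.ofAdd (0 : ℤ_[p])) ∈ D → x = 1 := by
    intro x hx
    by_contra hne
    obtain ⟨N, hN, hNo, hxN⟩ := exists_open_normal_notMem hne
    obtain ⟨k, hk⟩ := hpow N hN hNo γ
    refine hxN ?_
    have hcl : IsClosed {y : Γ × Multiplicative ℤ_[p] |
        Multiplicative.toAdd y.2 ∈ Metric.closedBall (0 : ℤ_[p]) ((p : ℝ) ^ (-(k : ℤ))) →
          y.1 ∈ N} := by
      refine isClosed_imp ?_ ?_
      · exact (IsUltrametricDist.isClopen_closedBall (0 : ℤ_[p])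
          (zpow_ne_zero _ hp0)).isOpen.preimage (continuous_toAdd.comp continuous_snd)
      · exact (N.isClosed_of_isOpen hNo).preimage continuous_fst
    refine hclosure _ hcl ?_ _ hx ?_
    · intro n hn
      rw [toAdd_ofAdd, mem_closedBall_zero_iff] at hn
      obtain ⟨j, rfl⟩ := PadicInt.norm_int_le_pow_iff_dvd.1 hn
      change γ ^ ((p : ℤ) ^ k * j) ∈ N
      rw [zpow_mul]
      exact N.zpow_mem (by exact_mod_cast hk) j
    · change (0 : ℤ_[p]) ∈ _
      rw [mem_closedBall_zero_iff, norm_zero]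
      positivity
  have hi₁ : ∀ t : ℤ_[p], (1, Multiplicative.ofAdd t) ∈ D → t = 0 := by
    intro t ht
    -- Otherwise the fibre over `1` contains an open subgroup of `ℤ_p`, and `Γ` is finite.
    by_contra hne
    have hmul : ∀ s : ℤ_[p], (1, Multiplicative.ofAdd (s * t)) ∈ D := by
      intro s
      refine PadicInt.denseRange_intCast.induction_on (p := fun s : ℤ_[p] =>
        ((1 : Γ), Multiplicative.ofAdd (s * t)) ∈ D) s ?_ fun n => ?_
      · exact hDcl.preimage (by fun_prop)
      · have := D.zpow_mem ht n
        simpa only [Prod.pow_mk, one_zpow, ← ofAdd_zsmul, zsmul_eq_mul] using this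
    choose s hs using fun x : Γ => hs₁ x
    have hinj : Function.Injective fun x : Γ =>
        PadicInt.toZModPow t.valuation
          (Multiplicative.toAdd (s x : Γ × Multiplicative ℤ_[p]).2) := by
      intro x y hxy
      have h1 : Multiplicative.toAdd (s x : Γ × Multiplicative ℤ_[p]).2 -
          Multiplicative.toAdd (s y : Γ × Multiplicative ℤ_[p]).2 ∈
          RingHom.ker (PadicInt.toZModPow (p := p) t.valuation) := by
        rw [RingHom.mem_ker, map_sub, sub_eq_zero]; exact hxy
      rw [PadicInt.ker_toZModPow, Ideal.mem_span_singleton] at h1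
      obtain ⟨r, hr⟩ := h1
      have h2 := hmul ((PadicInt.unitCoeff hne)⁻¹.1 * r)
      have h3 : ((PadicInt.unitCoeff hne)⁻¹.1 * r) * t =
          Multiplicative.toAdd (s x : Γ × Multiplicative ℤ_[p]).2 -
          Multiplicative.toAdd (s y : Γ × Multiplicative ℤ_[p]).2 := by
        rw [hr]
        calc _ = (PadicInt.unitCoeff hne)⁻¹.1 * r *
              ((PadicInt.unitCoeff hne).1 * (p : ℤ_[p]) ^ t.valuation) := by
                rw [← PadicInt.unitCoeff_spec hne]
          _ = ((PadicInt.unitCoeff hne)⁻¹.1 * (PadicInt.unitCoeff hne).1) *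
              ((p : ℤ_[p]) ^ t.valuation * r) := by ring
          _ = _ := by rw [Units.inv_mul, one_mul]
      rw [h3] at h2
      have h4 := D.mul_mem (D.mul_mem (s x).2 (D.inv_mem (s y).2)) (D.inv_mem h2)
      have h5 : (s x : Γ × Multiplicative ℤ_[p]) * (s y : Γ × Multiplicative ℤ_[p])⁻¹ *
          (1, Multiplicative.ofAdd (Multiplicative.toAdd (s x : Γ × Multiplicative ℤ_[p]).2 -
          Multiplicative.toAdd (s y : Γ × Multiplicative ℤ_[p]).2))⁻¹ =
          (x * y⁻¹, Multiplicative.ofAdd 0) := by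
        refine Prod.ext ?_ ?_
        · change (s x : Γ × Multiplicative ℤ_[p]).1 * ((s y : Γ × Multiplicative ℤ_[p]).1)⁻¹ * 1⁻¹
            = _
          rw [inv_one, mul_one]
          exact congrArg₂ (fun u w => u * w⁻¹) (hs x) (hs y)
        · apply Multiplicative.toAdd.injective
          change Multiplicative.toAdd (s x : Γ × Multiplicative ℤ_[p]).2 +
            -Multiplicative.toAdd (s y : Γ × Multiplicative ℤ_[p]).2 + -(_ - _) = (0 : ℤ_[p])
          abel
      rw [h5] at h4
      exact mul_inv_eq_one.1 (hi₂ _ h4)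
    exact not_finite_iff_infinite.2 ‹Infinite Γ› (Finite.of_injective _ hinj)
  have hb₁ : Function.Bijective π₁ := by
    refine ⟨(injective_iff_map_eq_one π₁).2 ?_, hs₁⟩
    rintro ⟨⟨x, t⟩, hx⟩ (rfl : x = 1)
    have := hi₁ (Multiplicative.toAdd t) hx
    exact Subtype.ext (Prod.ext rfl this)
  have hb₂ : Function.Bijective π₂ := by
    refine ⟨(injective_iff_map_eq_one π₂).2 ?_, hs₂⟩
    rintro ⟨⟨x, t⟩, hx⟩ (rfl : t = 1)
    have := hi₂ x hx
    exact Subtype.ext (Prod.ext this rfl)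
  obtain ⟨e₁⟩ := nonempty_continuousMulEquiv_of_bijective π₁ hπ₁ hb₁
  obtain ⟨e₂⟩ := nonempty_continuousMulEquiv_of_bijective π₂ hπ₂ hb₂
  exact ⟨e₁.symm.trans e₂⟩

end ProfiniteGroups

/-! ### Profinite elementary abelian groups -/

section ElementaryAbelian

/-- Linearly independent functionals take arbitrary values simultaneously. -/
theorem exists_forall_dual_apply_eq {F A ι : Type*} [Field F] [AddCommGroup A] [Module F A]
    {χ : ι → Module.Dual F A} (hχ : LinearIndependent F χ) (s : Finset ι) (y : ι → F) :
    ∃ x : A, ∀ i ∈ s, χ i x = y i := by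
  let f : A →ₗ[F] (s → F) := LinearMap.pi fun i => χ i
  have hf : LinearMap.range f = ⊤ := by
    by_contra hne
    obtain ⟨g, hg0, hg⟩ := Submodule.exists_le_ker_of_lt_top _ (lt_top_iff_ne_top.2 hne)
    apply hg0
    have hli : LinearIndependent F fun i : s => χ i := hχ.comp _ Subtype.val_injective
    rw [Fintype.linearIndependent_iff] at hli
    classical
    have h1 : ∀ w : s → F, g w = ∑ i, g (Pi.single i 1) * w i := by
      intro w
      conv_lhs => rw [pi_eq_sum_univ' w, map_sum]
      refine Finset.sum_congr rfl fun i _ => ?_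
      rw [map_smul, smul_eq_mul, mul_comm]
    have h2 := hli (fun i => g (Pi.single i 1)) (by
      ext x
      have h3 : g (f x) = 0 := hg ⟨x, rfl⟩
      rw [h1] at h3
      simpa [f] using h3)
    refine LinearMap.ext fun w => ?_
    rw [h1]
    simp [h2]
  obtain ⟨x, hx⟩ := LinearMap.range_eq_top.1 hf fun i => y i
  exact ⟨x, fun i hi => congrFun hx ⟨i, hi⟩⟩

/-- An infinite compact commutative group of exponent `p` with a countable neighbourhood basis of
the identity consisting of open subgroups is a countable power of `ℤ/p`. The coordinates are the
members of a basis of the space of continuous characters with values in `ℤ/p`. -/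
theorem nonempty_continuousMulEquiv_pi_zmod (p : ℕ) [Fact p.Prime] {G : Type*} [CommGroup G]
    [TopologicalSpace G] [IsTopologicalGroup G] [CompactSpace G] [T1Space G] [Infinite G]
    (hexp : ∀ x : G, x ^ p = 1) (N : ℕ → Subgroup G) (hNo : ∀ n, IsOpen (N n : Set G))
    (hN : ∀ U : Set G, IsOpen U → 1 ∈ U → ∃ n, (N n : Set G) ⊆ U) :
    Nonempty (G ≃ₜ* Multiplicative (ℕ → ZMod p)) := by
  let _ : Module (ZMod p) (Additive G) := AddCommGroup.zmodModule (n := p) (G := Additive G)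
    fun x => hexp x.toMul
  let V : Submodule (ZMod p) (Module.Dual (ZMod p) (Additive G)) :=
    { carrier := {χ | ∃ n, ∀ x ∈ N n, χ (Additive.ofMul x) = 0}
      zero_mem' := ⟨0, fun x _ => rfl⟩
      add_mem' := by
        rintro χ ψ ⟨n, hn⟩ ⟨m, hm⟩
        obtain ⟨l, hl⟩ := hN (N n ∩ N m) ((hNo n).inter (hNo m)) ⟨(N n).one_mem, (N m).one_mem⟩
        refine ⟨l, fun x hx => ?_⟩
        rw [LinearMap.add_apply, hn x (hl hx).1, hm x (hl hx).2, add_zero]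
      smul_mem' := by
        rintro r χ ⟨n, hn⟩
        exact ⟨n, fun x hx => by rw [LinearMap.smul_apply, hn x hx, smul_zero]⟩ }
  have hsep : ∀ x : G, (∀ χ ∈ V, χ (Additive.ofMul x) = 0) → x = 1 := by
    intro x hx
    by_contra hne
    obtain ⟨n, hn⟩ := hN {x}ᶜ isOpen_compl_singleton (fun h => hne h.symm)
    have hxn : Additive.ofMul x ∉ AddSubgroup.toZModSubmodule p (Subgroup.toAddSubgroup (N n)) :=
      fun h => hn h rfl
    obtain ⟨χ, hχx, hχ⟩ := Submodule.exists_le_ker_of_notMem hxn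
    exact hχx (hx χ ⟨n, fun y hy => hχ hy⟩)
  have hcount : Countable V := by
    have h1 : (V : Set (Module.Dual (ZMod p) (Additive G))) =
        ⋃ n, {χ | ∀ x ∈ N n, χ (Additive.ofMul x) = 0} := by
      ext χ; simp [V]
    have h2 : (V : Set (Module.Dual (ZMod p) (Additive G))).Countable := by
      rw [h1]
      refine Set.countable_iUnion fun n => Set.Finite.countable ?_
      have := Subgroup.quotient_finite_of_isOpen (N n) (hNo n)
      rw [← Set.finite_coe_iff]
      refine Finite.of_injective
        (fun χ : {χ : Module.Dual (ZMod p) (Additive G) | ∀ x ∈ N n, χ (Additive.ofMul x) = 0} =>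
          fun q : G ⧸ N n => χ.1 (Additive.ofMul q.out)) ?_
      rintro ⟨χ, hχ⟩ ⟨ψ, hψ⟩ h
      refine Subtype.ext (LinearMap.ext fun x => ?_)
      have key : ∀ φ : Module.Dual (ZMod p) (Additive G), (∀ x ∈ N n, φ (Additive.ofMul x) = 0) →
          φ x = φ (Additive.ofMul (QuotientGroup.mk x.toMul : G ⧸ N n).out) := by
        intro φ hφ
        obtain ⟨⟨y, hy⟩, hxy⟩ := QuotientGroup.mk_out_eq_mul (N n) x.toMul
        rw [hxy, ofMul_mul, map_add, hφ y hy, add_zero, ofMul_toMul]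
      change χ x = ψ x
      rw [key χ hχ, key ψ hψ]
      exact congrFun h _
    exact h2.to_subtype
  have hinf : Infinite V := by
    by_contra hfin
    rw [not_infinite_iff_finite] at hfin
    refine not_finite_iff_infinite.2 ‹Infinite G› (Finite.of_injective
      (fun x : G => fun χ : V => χ.1 (Additive.ofMul x)) ?_)
    intro x y hxy
    rw [← div_eq_one]
    refine hsep _ fun χ hχ => ?_
    rw [ofMul_div, map_sub, sub_eq_zero]
    exact congrFun hxy ⟨χ, hχ⟩
  let b := Module.Basis.ofVectorSpace (ZMod p) V
  have : Infinite (Module.Basis.ofVectorSpaceIndex (ZMod p) V) := by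
    by_contra hfin
    rw [not_infinite_iff_finite] at hfin
    have := Module.Finite.of_basis b
    exact not_finite_iff_infinite.2 hinf (Module.finite_of_finite (ZMod p))
  obtain ⟨_⟩ := nonempty_denumerable (Module.Basis.ofVectorSpaceIndex (ZMod p) V)
  let B : Module.Basis ℕ (ZMod p) V := b.reindex (Denumerable.eqv _)
  have hBli : LinearIndependent (ZMod p) fun i => (B i : Module.Dual (ZMod p) (Additive G)) :=
    B.linearIndependent.map' V.subtype (Submodule.ker_subtype V)
  have hcont : ∀ χ ∈ V, Continuous fun x : G => χ (Additive.ofMul x) := by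
    rintro χ ⟨n, hn⟩
    refine IsLocallyConstant.continuous ((IsLocallyConstant.iff_exists_open _).2 fun x => ?_)
    refine ⟨(fun y => x⁻¹ * y) ⁻¹' (N n), (hNo n).preimage (continuous_const_mul _), ?_, ?_⟩
    · simp
    · intro y hy
      have := hn _ hy
      rw [ofMul_mul, ofMul_inv, map_add, map_neg, neg_add_eq_zero] at this
      exact this.symm
  let Φ : G →* Multiplicative (ℕ → ZMod p) :=
    { toFun := fun x => Multiplicative.ofAdd fun i => (B i).1 (Additive.ofMul x)
      map_one' := by
        apply Multiplicative.toAdd.injective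
        ext i
        simp
      map_mul' := fun x y => by
        apply Multiplicative.toAdd.injective
        ext i
        simp }
  have hΦ : Continuous Φ :=
    continuous_ofAdd.comp (continuous_pi fun i => hcont _ (B i).2)
  refine nonempty_continuousMulEquiv_of_bijective Φ hΦ
    ⟨(injective_iff_map_eq_one Φ).2 fun x hx => ?_, fun y => ?_⟩
  · refine hsep x fun χ hχ => ?_
    have h1 : (LinearMap.applyₗ (Additive.ofMul x)).comp V.subtype = 0 :=
      B.ext fun i => congrFun (congrArg Multiplicative.toAdd hx) i
    exact LinearMap.congr_fun h1 ⟨χ, hχ⟩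
  · let S : ℕ → Set G := fun n => {x | ∀ i ∈ Finset.range n,
      (B i).1 (Additive.ofMul x) = Multiplicative.toAdd y i}
    have hScl : ∀ n, IsClosed (S n) := by
      intro n
      have : S n = ⋂ i ∈ Finset.range n, {x | (B i).1 (Additive.ofMul x) =
          Multiplicative.toAdd y i} := by
        ext x; simp [S]
      rw [this]
      exact isClosed_biInter fun i _ => isClosed_eq (hcont _ (B i).2) continuous_const
    obtain ⟨x, hx⟩ := IsCompact.nonempty_iInter_of_sequence_nonempty_isCompact_isClosed S
      (fun n x hx i hi => hx i (Finset.range_mono n.le_succ hi))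
      (fun n => by
        obtain ⟨x, hx⟩ := exists_forall_dual_apply_eq hBli (Finset.range n) (Multiplicative.toAdd y)
        exact ⟨x.toMul, hx⟩)
      (hScl 0).isCompact hScl
    refine ⟨x, ?_⟩
    apply Multiplicative.toAdd.injective
    funext i
    exact Set.mem_iInter.1 hx (i + 1) i (Finset.self_mem_range_succ i)

end ElementaryAbelian

/-! ### The absolute value and the residue field of an algebraic extension of `ℚ_p` -/

section SpectralValuation

variable (p : ℕ) [hp : Fact p.Prime] {L : Type*} [Field L] [Algebra ℚ_[p] L]

/-- The absolute value on an algebraic extension of `ℚ_p` that extends the `p`-adic one, as a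
multiplicative valuation with values in `ℝ≥0`. -/
noncomputable def absVal (L : Type*) [Field L] [Algebra ℚ_[p] L] [Algebra.IsAlgebraic ℚ_[p] L] :
    Valuation L ℝ≥0 where
  toFun x := ⟨spectralNorm ℚ_[p] L x, spectralNorm_nonneg x⟩
  map_zero' := Subtype.ext spectralNorm_zero
  map_one' := Subtype.ext spectralNorm_one
  map_mul' x y := Subtype.ext (map_mul (spectralMulAlgNorm ℚ_[p] L) x y)
  map_add_le_max' x y := isNonarchimedean_spectralNorm (K := ℚ_[p]) (L := L) x y

variable [Algebra.IsAlgebraic ℚ_[p] L]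

theorem coe_absVal (x : L) : (absVal p L x : ℝ) = spectralNorm ℚ_[p] L x := rfl

theorem absVal_algebraMap (x : ℚ_[p]) : (absVal p L (algebraMap ℚ_[p] L x) : ℝ) = ‖x‖ :=
  spectralNorm_extends x

theorem absVal_natCast_prime : absVal p L (p : L) = (p : ℝ≥0)⁻¹ := by
  apply NNReal.coe_injective
  have := absVal_algebraMap p (L := L) (p : ℚ_[p])
  rw [map_natCast, Padic.norm_p] at this
  rw [this, NNReal.coe_inv, NNReal.coe_natCast]

theorem val_nonneg_iff (x : L) : 0 ≤ val p x ↔ absVal p L x ≤ 1 := by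
  rw [zero_le_val_iff, ← coe_absVal, ← NNReal.coe_one, NNReal.coe_le_coe]

theorem val_pos_iff (x : L) : 0 < val p x ↔ absVal p L x < 1 := by
  rw [zero_lt_val_iff, ← coe_absVal, ← NNReal.coe_one, NNReal.coe_lt_coe]

/-- The absolute values above `1` on an extension of bounded degree stay away from `1`. -/
theorem le_absVal_pow {x : L} (hx : 1 < absVal p L x) {d : ℕ}
    (hd : (minpoly ℚ_[p] x).natDegree ≤ d) : (p : ℝ≥0) ≤ absVal p L x ^ d := by
  set n := (minpoly ℚ_[p] x).natDegree with hn
  have hn0 : n ≠ 0 := (minpoly.natDegree_pos (Algebra.IsIntegral.isIntegral x)).ne'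
  have h1 : (absVal p L x : ℝ) ^ n = ‖(minpoly ℚ_[p] x).coeff 0‖ := by
    rw [coe_absVal, spectralNorm.spectralNorm_eq_norm_coeff_zero_rpow, ← hn, one_div,
      Real.rpow_inv_natCast_pow (norm_nonneg _) hn0]
  have h2 : 1 < ‖(minpoly ℚ_[p] x).coeff 0‖ := by
    rw [← h1]
    exact one_lt_pow₀ (by exact_mod_cast hx) hn0
  have h0 : (minpoly ℚ_[p] x).coeff 0 ≠ 0 := by
    intro h
    rw [h, norm_zero] at h2
    exact absurd h2 (not_lt.2 zero_le_one)
  have h3 : (p : ℝ) ≤ ‖(minpoly ℚ_[p] x).coeff 0‖ := by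
    rw [Padic.norm_eq_zpow_neg_valuation h0] at h2 ⊢
    have h4 := (one_lt_zpow_iff_right₀ (one_lt_cast p)).1 h2
    calc (p : ℝ) = (p : ℝ) ^ (1 : ℤ) := (zpow_one _).symm
      _ ≤ _ := zpow_le_zpow_right₀ (one_lt_cast p).le h4
  have h5 : (p : ℝ≥0) ≤ absVal p L x ^ n := by
    rw [← NNReal.coe_le_coe]
    push_cast
    rw [h1]
    exact h3
  exact h5.trans (pow_le_pow_right₀ hx.le hd)

/-- The residue field of an algebraic extension of `ℚ_p`. -/
abbrev Residue (L : Type*) [Field L] [Algebra ℚ_[p] L] [Algebra.IsAlgebraic ℚ_[p] L] : Type _ :=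
  IsLocalRing.ResidueField (absVal p L).valuationSubring

theorem residue_natCast_prime : ((p : ℕ) : Residue p L) = 0 := by
  rw [← map_natCast (IsLocalRing.residue (absVal p L).valuationSubring),
    IsLocalRing.residue_eq_zero_iff, Valuation.mem_maximalIdeal_iff]
  have h1 : ((p : (absVal p L).valuationSubring) : L) = (p : L) := by simp
  rw [h1, absVal_natCast_prime]
  exact inv_lt_one_of_one_lt₀ (by exact_mod_cast hp.out.one_lt)

instance residue_charP : CharP (Residue p L) p :=
  (CharP.charP_iff_prime_eq_zero hp.out).2 (residue_natCast_prime p)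

noncomputable instance residueAlgebra : Algebra (ZMod p) (Residue p L) := ZMod.algebra _ p

/-- The inclusion of `ℤ_p` into the valuation ring of an algebraic extension of `ℚ_p`. -/
noncomputable def padicIntToIntegers (L : Type*) [Field L] [Algebra ℚ_[p] L]
    [Algebra.IsAlgebraic ℚ_[p] L] : ℤ_[p] →+* (absVal p L).valuationSubring :=
  RingHom.codRestrict ((algebraMap ℚ_[p] L).comp PadicInt.Coe.ringHom)
    (absVal p L).valuationSubring fun z => by
      rw [Valuation.mem_valuationSubring_iff, ← NNReal.coe_le_coe]
      exact (absVal_algebraMap p _).trans_le z.2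

theorem residue_padicInt (z : ℤ_[p]) :
    IsLocalRing.residue (absVal p L).valuationSubring (padicIntToIntegers p L z) =
      algebraMap (ZMod p) (Residue p L) (PadicInt.toZMod z) := by
  have h1 := PadicInt.toZMod_spec z
  rw [PadicInt.maximalIdeal_eq_span_p, Ideal.mem_span_singleton] at h1
  obtain ⟨w, hw⟩ := h1
  rw [sub_eq_iff_eq_add] at hw
  conv_lhs => rw [hw]
  rw [map_add, map_add, map_mul, map_mul, map_natCast, map_natCast, residue_natCast_prime,
    zero_mul, zero_add, ZMod.cast_eq_val, map_natCast, map_natCast]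
  conv_rhs => rw [← ZMod.natCast_zmod_val (PadicInt.toZMod z), map_natCast]

/-- The minimal polynomial over `ℚ_p` of an integer has integral coefficients, and reduces to
a polynomial over `𝔽_p` that annihilates the residue class. -/
theorem exists_monic_aeval_residue (x : (absVal p L).valuationSubring) :
    ∃ Q : Polynomial (ZMod p), Q.Monic ∧ Q.natDegree = (minpoly ℚ_[p] (x : L)).natDegree ∧
      Polynomial.aeval (IsLocalRing.residue (absVal p L).valuationSubring x : Residue p L) Q
        = 0 := by
  have hmonic := minpoly.monic (Algebra.IsIntegral.isIntegral (R := ℚ_[p]) (x : L))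
  have hcoeff := (spectralValue_le_one_iff hmonic).1
    (show spectralNorm ℚ_[p] L (x : L) ≤ 1 by
      rw [← coe_absVal]; exact_mod_cast x.2)
  have hlift : minpoly ℚ_[p] (x : L) ∈ Polynomial.lifts (PadicInt.Coe.ringHom (p := p)) := by
    rw [Polynomial.lifts_iff_coeff_lifts]
    exact fun n => ⟨⟨_, hcoeff n⟩, rfl⟩
  obtain ⟨P, hP, hdeg, hPm⟩ := Polynomial.lifts_and_natDegree_eq_and_monic hlift hmonic
  refine ⟨P.map PadicInt.toZMod, hPm.map _, by rw [hPm.natDegree_map, hdeg], ?_⟩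
  have h1 : (algebraMap (ZMod p) (Residue p L)).comp PadicInt.toZMod =
      (IsLocalRing.residue (absVal p L).valuationSubring).comp (padicIntToIntegers p L) :=
    RingHom.ext fun z => (residue_padicInt p z).symm
  rw [Polynomial.aeval_def, Polynomial.eval₂_map, h1, ← Polynomial.hom_eval₂]
  have h2 : Polynomial.eval₂ (padicIntToIntegers p L) x P = 0 := by
    apply Subtype.val_injective
    have h3 := minpoly.aeval ℚ_[p] (x : L)
    rw [← hP, Polynomial.aeval_def, Polynomial.eval₂_map] at h3
    exact (Polynomial.hom_eval₂ P (padicIntToIntegers p L)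
      (absVal p L).valuationSubring.subtype x).trans h3
  rw [h2, map_zero]

instance residue_isAlgebraic : Algebra.IsAlgebraic (ZMod p) (Residue p L) where
  isAlgebraic r := by
    obtain ⟨x, rfl⟩ := IsLocalRing.residue_surjective r
    obtain ⟨Q, hQ, -, h⟩ := exists_monic_aeval_residue p x
    exact ⟨Q, hQ.ne_zero, h⟩

/-- A uniform version of the finiteness of the residue fields of finite extensions of `ℚ_p`. -/
theorem absVal_pow_sub_lt_one {x : L} (hx : absVal p L x ≤ 1) {d : ℕ}
    (hd : (minpoly ℚ_[p] x).natDegree ≤ d) : absVal p L (x ^ p ^ d.factorial - x) < 1 := by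
  let y : (absVal p L).valuationSubring := ⟨x, hx⟩
  have h1 := (residue_eq_residue_iff (absVal p L) (y ^ p ^ d.factorial) y).1
  refine h1 ?_
  set r : Residue p L := IsLocalRing.residue (absVal p L).valuationSubring y with hr
  rw [map_pow, ← hr]
  obtain ⟨Q, hQ, hdeg, h⟩ := exists_monic_aeval_residue p y
  have hint : IsIntegral (ZMod p) r := Algebra.IsIntegral.isIntegral r
  let F := IntermediateField.adjoin (ZMod p) {r}
  have hfin : FiniteDimensional (ZMod p) F := IntermediateField.adjoin.finiteDimensional hint
  have : Finite F := Module.finite_of_finite (ZMod p)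
  have := Fintype.ofFinite F
  have hn : Module.finrank (ZMod p) F ≤ d := by
    rw [IntermediateField.adjoin.finrank hint]
    refine le_trans ?_ (hdeg.le.trans hd)
    exact Polynomial.natDegree_le_natDegree (minpoly.min _ _ hQ h)
  have hcard : Fintype.card F = p ^ Module.finrank (ZMod p) F := by
    rw [Module.card_eq_pow_finrank (K := ZMod p), ZMod.card]
  obtain ⟨m, hm⟩ := Nat.dvd_factorial Module.finrank_pos hn
  have h2 := FiniteField.pow_card_pow m (⟨r, IntermediateField.mem_adjoin_simple_self _ r⟩ : F)
  rw [hcard, ← pow_mul, ← hm] at h2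
  exact congrArg Subtype.val h2

end SpectralValuation

/-! ### Inertia subgroups of automorphism groups -/

section PowerTorsion

/-- If each point is fixed by the `p ^ k`-th power of each group element, for some `k` that depends
on both, then the finite orbits have `p`-power size. -/
theorem exists_card_orbit_eq_pow {p : ℕ} [Fact p.Prime] {P α : Type*} [Group P] [MulAction P α]
    (h : ∀ (σ : P) (y : α), ∃ k, σ ^ p ^ k • y = y) (x : α) [Finite (MulAction.orbit P x)] :
    ∃ k, Nat.card (MulAction.orbit P x) = p ^ k := by
  let R := (MulAction.toPermHom P (MulAction.orbit P x)).range
  have hR : IsPGroup p R := by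
    rintro ⟨_, σ, rfl⟩
    choose k hk using fun y : MulAction.orbit P x => h σ y
    obtain ⟨M, hM⟩ := (Set.finite_range k).bddAbove
    refine ⟨M, Subtype.ext (Equiv.ext fun y => Subtype.ext ?_)⟩
    have h1 : k y ≤ M := hM ⟨y, rfl⟩
    have h2 : ∀ n : ℕ, (σ ^ p ^ k y) ^ n • (y : α) = y := by
      intro n
      induction n with
      | zero => rw [pow_zero, one_smul]
      | succ n ih => rw [pow_succ, mul_smul, hk, ih]
    have h3 := h2 (p ^ (M - k y))
    rw [← pow_mul, ← pow_add, Nat.add_sub_cancel' h1] at h3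
    change ((((MulAction.toPermHom P (MulAction.orbit P x)) σ) ^ p ^ M) y : α) = y
    rw [← map_pow]
    exact h3
  obtain ⟨k, hk⟩ := hR.card_orbit (⟨x, MulAction.mem_orbit_self x⟩ : MulAction.orbit P x)
  refine ⟨k, hk ▸ ?_⟩
  have : MulAction.orbit R (⟨x, MulAction.mem_orbit_self x⟩ : MulAction.orbit P x) = Set.univ := by
    refine Set.eq_univ_of_forall ?_
    rintro ⟨_, σ, rfl⟩
    exact ⟨⟨_, σ, rfl⟩, rfl⟩
  rw [this, Nat.card_univ]

end PowerTorsion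

theorem isOpen_setOf_apply {K E : Type*} [Field K] [Field E] [Algebra K E] [Algebra.IsIntegral K E]
    (x : E) (P : E → Prop) : IsOpen {σ : Gal(E/K) | P (σ x)} := by
  rw [isOpen_iff_mem_nhds]
  intro τ hτ
  have h1 := (stabilizer_isOpen_of_isIntegral (K := K) x).preimage (continuous_const_mul τ⁻¹)
  refine Filter.mem_of_superset (h1.mem_nhds ?_) ?_
  · simp
  · intro σ hσ
    have h2 : τ⁻¹ (σ x) = x := hσ
    have h3 : τ x = σ x := by
      conv_lhs => rw [← h2]
      exact AlgEquiv.apply_symm_apply τ (σ x)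
    change P (σ x)
    rwa [← h3]

theorem exists_pow_mem_of_isOpen {p : ℕ} {K E : Type*} [Field K] [Field E] [Algebra K E]
    {σ : Gal(E/K)} (h : ∀ x : E, ∃ k, (σ ^ p ^ k) x = x) {U : Set Gal(E/K)}
    (hU : IsOpen U) (h1U : 1 ∈ U) : ∃ k, σ ^ p ^ k ∈ U := by
  obtain ⟨T, hT, hTN⟩ := (krullTopology_mem_nhds_one_iff K E _).1 (hU.mem_nhds h1U)
  let b := Module.finBasis K T
  choose k hk using fun i => h (b i)
  obtain ⟨M, hM⟩ := (Set.finite_range k).bddAbove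
  refine ⟨M, hTN fun x => ?_⟩
  have hb : ∀ i, (σ ^ p ^ M) (b i) = b i := by
    intro i
    have h1 : k i ≤ M := hM ⟨i, rfl⟩
    have h2 : σ ^ p ^ k i ∈ MulAction.stabilizer Gal(E/K) (b i : E) := hk i
    have h3 := Subgroup.pow_mem _ h2 (p ^ (M - k i))
    rw [← pow_mul, ← pow_add, Nat.add_sub_cancel' h1] at h3
    exact h3
  change (σ ^ p ^ M) (x : E) = x
  have hx := congrArg (T.val) (b.sum_repr x)
  rw [map_sum] at hx
  simp only [map_smul] at hx
  change _ = (x : E) at hx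
  rw [← hx, map_sum]
  refine Finset.sum_congr rfl fun i _ => ?_
  rw [map_smul]
  exact congrArg _ (hb i)

theorem finite_orbit_of_isIntegral {K E P : Type*} [Field K] [Field E] [Algebra K E]
    [Algebra.IsIntegral K E] [Group P] [MulAction P E]
    (hP : ∀ σ : P, ∃ g : Gal(E/K), ∀ x : E, σ • x = g x) (x : E) :
    Finite (MulAction.orbit P x) := by
  have h0 : minpoly K x ≠ 0 := minpoly.ne_zero (Algebra.IsIntegral.isIntegral x)
  refine Set.Finite.subset ((minpoly K x).rootSet_finite E) ?_
  rintro _ ⟨σ, rfl⟩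
  obtain ⟨g, hg⟩ := hP σ
  change σ • x ∈ _
  rw [hg, Polynomial.mem_rootSet]
  refine ⟨h0, ?_⟩
  rw [Polynomial.aeval_algEquiv]
  simp

theorem natDegree_minpoly_le {F K E : Type*} [Field F] [Field K] [Field E] [Algebra K E]
    [Algebra F K] [Algebra F E] [IsScalarTower F K E] (T : IntermediateField K E)
    [FiniteDimensional F T] {y : E} (hy : y ∈ T) :
    (minpoly F y).natDegree ≤ Module.finrank F T := by
  have h1 : minpoly F y = minpoly F (⟨y, hy⟩ : T) :=
    minpoly.algHom_eq (T.val.restrictScalars F) Subtype.val_injective ⟨y, hy⟩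
  rw [h1]
  exact minpoly.natDegree_le _

section Inertia

variable (p : ℕ) [hp : Fact p.Prime] {K E : Type*} [Field K] [Field E] [Algebra K E]
  [Algebra ℚ_[p] E] [Algebra.IsAlgebraic ℚ_[p] E]

/-- `I` is the inertia subgroup of `Aut(E/K)`, expressed through the absolute value of `E`. -/
def IsInertia (I : Subgroup Gal(E/K)) : Prop :=
  ∀ σ, σ ∈ I ↔ ∀ x : E, absVal p E x ≤ 1 → absVal p E (σ x - x) < 1

variable {p} {I : Subgroup Gal(E/K)}

theorem isClosed_inertia [Algebra.IsIntegral K E] (hI : IsInertia p I) :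
    IsClosed (I : Set Gal(E/K)) := by
  have h1 : (I : Set Gal(E/K)) = ⋂ (x : E) (_ : absVal p E x ≤ 1),
      {σ : Gal(E/K) | absVal p E (σ x - x) < 1} := by
    ext σ
    simp only [SetLike.mem_coe, hI σ, Set.mem_iInter, Set.mem_ofPred_eq]
  rw [h1]
  refine isClosed_iInter fun x => isClosed_iInter fun _ => ?_
  rw [← isOpen_compl_iff]
  exact isOpen_setOf_apply x fun y => ¬ absVal p E (y - x) < 1

/-- By compactness, membership in an open set that contains the inertia elements is detected by the
action on finitely many residue classes. -/
theorem exists_finite_residue_test [Algebra.IsIntegral K E] (hI : IsInertia p I)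
    {C U : Set Gal(E/K)} (hC : IsCompact C) (hU : IsOpen U) (hsub : ∀ σ ∈ C, σ ∈ I → σ ∈ U) :
    ∃ X : Set E, X.Finite ∧ (∀ x ∈ X, absVal p E x ≤ 1) ∧
      ∀ σ ∈ C, (∀ x ∈ X, absVal p E (σ x - x) < 1) → σ ∈ U := by
  obtain ⟨u, hu⟩ := (hC.diff hU).elim_finite_subfamily_closed
    (fun x : (absVal p E).valuationSubring =>
      {σ : Gal(E/K) | absVal p E (σ (x : E) - x) < 1})
    (fun x => by
      rw [← isOpen_compl_iff]
      exact isOpen_setOf_apply (x : E) fun y => ¬ absVal p E (y - x) < 1) (by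
      rw [Set.eq_empty_iff_forall_notMem]
      rintro σ ⟨⟨hσC, hσU⟩, hσ⟩
      refine hσU (hsub σ hσC ((hI σ).2 fun x hx => ?_))
      exact Set.mem_iInter.1 hσ ⟨x, hx⟩)
  refine ⟨Subtype.val '' (u : Set (absVal p E).valuationSubring), u.finite_toSet.image _, ?_, ?_⟩
  · rintro _ ⟨x, -, rfl⟩
    exact x.2
  · intro σ hσC hσ
    by_contra hσU
    rw [Set.eq_empty_iff_forall_notMem] at hu
    refine hu σ ⟨⟨hσC, hσU⟩, ?_⟩
    simp only [Set.mem_iInter]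
    exact fun x hx => hσ x ⟨x, hx, rfl⟩

/-- Residue classes on which a group of automorphisms with `p`-power orbits acts trivially lift to
the fixed field. -/
theorem exists_fixed_lift [Algebra.IsIntegral K E] {P : Type*} [Group P] [MulSemiringAction P E]
    (hP : ∀ σ : P, ∃ g : Gal(E/K), ∀ x : E, σ • x = g x)
    (hpt : ∀ (σ : P) (x : E), ∃ k, σ ^ p ^ k • x = x) {x : E} (hx : absVal p E x ≤ 1)
    (hfix : ∀ σ : P, absVal p E (σ • x - x) < 1) :
    ∃ y, absVal p E y ≤ 1 ∧ (∀ σ : P, σ • y = y) ∧ absVal p E (y - x) < 1 := by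
  have := finite_orbit_of_isIntegral hP x
  obtain ⟨k, hk⟩ := exists_card_orbit_eq_pow hpt x
  exact exists_invariant_lift hx hfix hp.out.ne_zero (Nat.factorial_pos _) hk
    (absVal_pow_sub_lt_one p hx le_rfl)

variable [Algebra ℚ_[p] K] [IsScalarTower ℚ_[p] K E]

theorem absVal_aut (σ : Gal(E/K)) (x : E) : absVal p E (σ x) = absVal p E x :=
  Subtype.ext (spectralNorm_eq_of_equiv (σ.restrictScalars ℚ_[p]) x).symm

/-- The action of `Aut(E/K)` on the valuation ring of `E`. -/
noncomputable instance integersAction (p : ℕ) [Fact p.Prime] (K E : Type*) [Field K] [Field E]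
    [Algebra K E] [Algebra ℚ_[p] E] [Algebra.IsAlgebraic ℚ_[p] E] [Algebra ℚ_[p] K]
    [IsScalarTower ℚ_[p] K E] : MulSemiringAction Gal(E/K) (absVal p E).valuationSubring where
  smul σ x := ⟨σ x, by rw [Valuation.mem_valuationSubring_iff, absVal_aut]; exact x.2⟩
  one_smul x := rfl
  mul_smul σ τ x := rfl
  smul_zero σ := Subtype.ext (map_zero σ)
  smul_add σ x y := Subtype.ext (map_add σ (x : E) y)
  smul_one σ := Subtype.ext (map_one σ)
  smul_mul σ x y := Subtype.ext (map_mul σ (x : E) y)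

theorem smul_residue_eq_iff (σ : Gal(E/K)) (x : (absVal p E).valuationSubring) :
    σ • IsLocalRing.residue (absVal p E).valuationSubring x =
      IsLocalRing.residue (absVal p E).valuationSubring x ↔ absVal p E (σ x - x) < 1 := by
  rw [← IsLocalRing.ResidueField.residue_smul]
  exact residue_eq_residue_iff (absVal p E) (σ • x) x

/-- The finite quotients of `Aut(E/K)/I` are cyclic. -/
theorem exists_generator_mod_open [Algebra.IsIntegral K E] [CompactSpace Gal(E/K)]
    (hI : IsInertia p I) {N : Subgroup Gal(E/K)} (hN : IsOpen (N : Set Gal(E/K))) (hIN : I ≤ N) :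
    ∃ γ, ∀ δ, ∃ i : ℤ, δ * γ ^ i ∈ N := by
  obtain ⟨X, hXf, hX, hXN⟩ := exists_finite_residue_test hI isCompact_univ hN
    (fun σ _ hσ => hIN hσ)
  have hfin : (IsLocalRing.residue (absVal p E).valuationSubring ''
      (Subtype.val ⁻¹' X)).Finite := (hXf.preimage Subtype.val_injective.injOn).image _
  obtain ⟨γ, hγ⟩ := exists_generator_mod_stabilizer p (k := Residue p E) (H := Gal(E/K)) _ hfin
  refine ⟨γ, fun δ => ?_⟩
  obtain ⟨i, hi⟩ := hγ δ
  refine ⟨i, ?_⟩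
  generalize δ * γ ^ i = σ at hi ⊢
  exact hXN σ trivial fun x hx => (smul_residue_eq_iff σ ⟨x, hX x hx⟩).1
    (hi _ ⟨⟨x, hX x hx⟩, hx, rfl⟩)

/-- If the residue field of `E` is infinite and `I` acts with `p`-power orbits, then the inertia
subgroup has infinite index: otherwise its fixed field is a finite extension of `K`, with a finite
residue field, which is the residue field of `E` as well. -/
theorem infinite_quotient_inertia [FiniteDimensional ℚ_[p] K] [IsGalois K E] [I.Normal]
    (hI : IsInertia p I) (hpt : ∀ σ ∈ I, ∀ x : E, ∃ k, (σ ^ p ^ k) x = x)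
    (hres : ∀ n : ℕ, ∃ S : Finset E, n < S.card ∧ (∀ x ∈ S, absVal p E x ≤ 1) ∧
      ∀ x ∈ S, ∀ y ∈ S, x ≠ y → absVal p E (x - y) = 1) : Infinite (Gal(E/K) ⧸ I) := by
  by_contra hfin
  rw [not_infinite_iff_finite] at hfin
  have hcl := isClosed_inertia hI
  have := Subgroup.finiteIndex_of_finite_quotient (H := I)
  have hop : IsOpen (I : Set Gal(E/K)) := Subgroup.isOpen_of_isClosed_of_finiteIndex I hcl
  let T := IntermediateField.fixedField I
  have hT : T.fixingSubgroup = I := InfiniteGalois.fixingSubgroup_fixedField ⟨I, hcl⟩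
  have hTK : FiniteDimensional K T := by
    refine (InfiniteGalois.isOpen_iff_finite T).1 ?_
    rw [hT]
    exact hop
  have hTp : FiniteDimensional ℚ_[p] T := Module.Finite.trans K T
  set d := Module.finrank ℚ_[p] T
  have hall : ∀ x : E, absVal p E x ≤ 1 → absVal p E (x ^ p ^ d.factorial - x) < 1 := by
    intro x hx
    obtain ⟨y, hy, hyI, hyx⟩ := exists_fixed_lift (K := K) (P := I)
      (fun σ => ⟨σ.1, fun _ => rfl⟩) (fun σ z => hpt σ.1 σ.2 z) hx
      (fun σ => (hI σ.1).1 σ.2 x hx)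
    have hyT : y ∈ T := fun σ => hyI σ
    have h1 := absVal_pow_sub_lt_one p hy (natDegree_minpoly_le T hyT)
    have hxy : absVal p E (x - y) < 1 := by rwa [Valuation.map_sub_swap]
    exact val_sub_lt_one_trans _ (val_pow_sub_pow_lt_one _ hy hxy _)
      (val_sub_lt_one_trans _ h1 hyx)
  -- Every residue class is a root of `X ^ q - X` with `q = p ^ d!`, but there are more than `q`.
  obtain ⟨S, hS, hSint, hSd⟩ := hres (p ^ d.factorial)
  classical
  let Q : Polynomial (Residue p E) := Polynomial.X ^ p ^ d.factorial - Polynomial.X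
  have hq : 1 < p ^ d.factorial := Nat.one_lt_pow (Nat.factorial_pos _).ne' hp.out.one_lt
  have hQ : Q.natDegree = p ^ d.factorial := FiniteField.X_pow_card_sub_X_natDegree_eq _ hq
  have hQ0 : Q ≠ 0 := FiniteField.X_pow_card_sub_X_ne_zero _ hq
  let f : S → Residue p E := fun x =>
    IsLocalRing.residue (absVal p E).valuationSubring ⟨x, hSint x x.2⟩
  have hf : Function.Injective f := by
    intro x y hxy
    by_contra hne
    have h1 := (residue_eq_residue_iff (absVal p E) _ _).1 hxy
    exact absurd (hSd x x.2 y y.2 fun h => hne (Subtype.ext h)) h1.ne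
  have h1 : (Finset.univ.image f) ⊆ Q.roots.toFinset := by
    intro r hr
    obtain ⟨x, -, rfl⟩ := Finset.mem_image.1 hr
    rw [Multiset.mem_toFinset, Polynomial.mem_roots hQ0]
    simp only [Q, Polynomial.IsRoot.def, Polynomial.eval_sub, Polynomial.eval_pow,
      Polynomial.eval_X, sub_eq_zero, f]
    rw [← map_pow]
    exact (residue_eq_residue_iff (absVal p E) _ _).2 (hall x (hSint x x.2))
  have h2 := Finset.card_le_card h1
  rw [Finset.card_image_of_injective _ hf, Finset.card_univ, Fintype.card_coe] at h2
  have h3 := (Multiset.toFinset_card_le Q.roots).trans Q.card_roots'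
  omega

/-- If the open subgroup of the automorphisms over `T` meets inertia trivially, and acts with
`p`-power orbits, then `E/T` is unramified in the sense that all absolute values of `E` are already
taken on `T`. -/
theorem exists_fixed_absVal_eq [IsGalois K E] (hI : IsInertia p I) (T : IntermediateField K E)
    (hTI : ∀ σ ∈ T.fixingSubgroup, σ ∈ I → σ = 1)
    (hpt : ∀ σ ∈ T.fixingSubgroup, ∀ x : E, ∃ k, (σ ^ p ^ k) x = x) {π : E} (hπ : π ≠ 0) :
    ∃ Y ∈ T, absVal p E Y = absVal p E π := by
  have hcl := InfiniteGalois.fixingSubgroup_isClosed T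
  have hcompact : CompactSpace T.fixingSubgroup := isCompact_iff_compactSpace.1 hcl.isCompact
  obtain ⟨X, hXf, hX, hXU⟩ := exists_finite_residue_test hI hcl.isCompact
    (isOpen_setOf_apply π fun y => y = π) fun σ hσ hσI => by
      rw [hTI σ hσ hσI]; rfl
  have hmul : ∀ (σ : Gal(E/K)) (x : E), absVal p E (σ x - x) < 1 →
      absVal p E (σ⁻¹ x - x) < 1 := by
    intro σ x h
    rw [← absVal_aut σ, map_sub, Valuation.map_sub_swap]
    have : σ (σ⁻¹ x) = x := AlgEquiv.apply_symm_apply σ x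
    rwa [this]
  -- By the choice of `X`, all members of this open subgroup fix `π`.
  let V : Subgroup T.fixingSubgroup :=
    { carrier := {σ | ∀ x ∈ X, absVal p E (σ.1 x - x) < 1}
      one_mem' := fun x _ => by simp
      mul_mem' := by
        intro σ τ hσ hτ x hx
        refine val_sub_lt_one_trans _ ?_ (hσ x hx)
        change absVal p E (σ.1 (τ.1 x) - σ.1 x) < 1
        rw [← map_sub, absVal_aut]
        exact hτ x hx
      inv_mem' := fun hσ x hx => hmul _ x (hσ x hx) }
  have hVo : IsOpen (V : Set T.fixingSubgroup) := by
    have h1 : (V : Set T.fixingSubgroup) = ⋂ x ∈ X,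
        Subtype.val ⁻¹' {σ : Gal(E/K) | absVal p E (σ x - x) < 1} := by
      ext σ
      simp [V]
    rw [h1]
    exact hXf.isOpen_biInter fun x _ =>
      (isOpen_setOf_apply x fun y => absVal p E (y - x) < 1).preimage continuous_subtype_val
  have := Subgroup.quotient_finite_of_isOpen V hVo
  have := Subgroup.finiteIndex_of_finite_quotient (H := V)
  obtain ⟨Y, hY, hYfix⟩ := exists_invariant_val_eq (v := absVal p E) (H := T.fixingSubgroup)
    (fun σ x => absVal_aut σ.1 x) V hπ (fun σ hσ => hXU σ.1 σ.2 hσ) (by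
      intro σ hσ x hx
      obtain ⟨y, hy, hyV, hyx⟩ := exists_fixed_lift (K := K) (P := V)
        (fun τ => ⟨τ.1.1, fun _ => rfl⟩) (fun τ z => hpt τ.1.1 τ.1.2 z) (hX x hx)
        (fun τ => τ.2 x hx)
      have h1 := hσ y hy fun τ hτ => hyV ⟨τ, hτ⟩
      have h2 : absVal p E (σ.1 x - σ.1 y) < 1 := by
        rw [← map_sub, absVal_aut, Valuation.map_sub_swap]; exact hyx
      exact val_sub_lt_one_trans _ h2 (val_sub_lt_one_trans _ h1 hyx))
  refine ⟨Y, ?_, hY⟩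
  rw [← InfiniteGalois.fixedField_fixingSubgroup T]
  exact fun σ => hYfix σ

/-- If arbitrarily small positive powers of an absolute value `r > 1` occur in `E`, then inertia is
infinite: otherwise they all occur in one finite extension of `K`, whose value group is discrete.
The group over which the `p`-power orbits are available is that of the automorphisms that fix the
`p`-th roots of unity. -/
theorem infinite_inertia_of_absVal [FiniteDimensional ℚ_[p] K] [IsGalois K E]
    (hI : IsInertia p I)
    (hpt : ∀ σ : Gal(E/K), (∀ η : E, η ^ p = 1 → σ η = η) → ∀ x : E, ∃ k, (σ ^ p ^ k) x = x)
    {r : ℝ≥0} (hr : 1 < r) (hval : ∀ n, ∃ x : E, absVal p E x ^ p ^ n = r) : Infinite I := by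
  by_contra hfin
  rw [not_infinite_iff_finite] at hfin
  have hfin' : (I : Set Gal(E/K)).Finite := hfin
  have hop : IsOpen (((I : Set Gal(E/K)) \ {1})ᶜ) := (hfin'.sdiff).isClosed.isOpen_compl
  obtain ⟨T₀, hT₀, hT₀I⟩ := (krullTopology_mem_nhds_one_iff K E _).1 (hop.mem_nhds (by simp))
  have hμ : {η : E | η ^ p = 1}.Finite := by
    have h0 : (Polynomial.X ^ p - 1 : Polynomial E) ≠ 0 := Polynomial.X_pow_sub_C_ne_zero
      hp.out.pos 1
    refine (Polynomial.finite_setOfPred_isRoot h0).subset fun η hη => ?_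
    simpa [sub_eq_zero] using hη
  have : Finite {η : E | η ^ p = 1} := hμ
  have hT₁ : FiniteDimensional K (IntermediateField.adjoin K {η : E | η ^ p = 1}) :=
    IntermediateField.finiteDimensional_adjoin fun x _ => Algebra.IsIntegral.isIntegral x
  -- The automorphisms over `T` fix the `p`-th roots of unity and meet inertia trivially.
  let T := T₀ ⊔ IntermediateField.adjoin K {η : E | η ^ p = 1}
  have hTK : FiniteDimensional K T := IntermediateField.finiteDimensional_sup _ _
  have hTp : FiniteDimensional ℚ_[p] T := Module.Finite.trans K T
  set d := Module.finrank ℚ_[p] T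
  have key : ∀ n : ℕ, (p : ℝ≥0) ^ p ^ n ≤ r ^ d := by
    intro n
    obtain ⟨x, hx⟩ := hval n
    have hx1 : 1 < absVal p E x := by
      by_contra! hle
      rw [← hx] at hr
      exact absurd hr (not_lt.2 (pow_le_one₀ zero_le hle))
    have hx0 : x ≠ 0 := (Valuation.ne_zero_iff _).1 (zero_lt_one.trans hx1).ne'
    obtain ⟨Y, hYT, hY⟩ := exists_fixed_absVal_eq hI T
      (fun σ hσ hσI => by
        by_contra hne
        refine hT₀I (fun y => ?_) ⟨hσI, hne⟩
        exact hσ ⟨y, (le_sup_left : T₀ ≤ T) y.2⟩)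
      (fun σ hσ => hpt σ fun η hη => hσ ⟨η, (le_sup_right :
        IntermediateField.adjoin K {η : E | η ^ p = 1} ≤ T)
          (IntermediateField.subset_adjoin K _ hη)⟩) hx0
    rw [← hx, ← pow_mul, mul_comm, pow_mul, ← hY]
    exact pow_le_pow_left₀ zero_le
      (le_absVal_pow p (hY ▸ hx1) (natDegree_minpoly_le T hYT)) _
  have hp1 : (1 : ℝ≥0) < p := by exact_mod_cast hp.out.one_lt
  obtain ⟨n, hn⟩ := pow_unbounded_of_one_lt (r ^ d) hp1
  refine absurd (hn.trans_le ?_) (not_lt.2 (key n))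
  exact pow_le_pow_right₀ hp1.le (Nat.lt_pow_self hp.out.one_lt).le

end Inertia

/-! ### Automorphisms acting on the levels of the tree -/

section Levels

/-- The `m`-th level of the tree of preimages of `a` under `z ↦ z ^ p - c` in an extension `E`
of `K`. -/
def levelSet (p : ℕ) {K : Type*} [Field K] (E : Type*) [Field E] [Algebra K E] (a c : K) (m : ℕ) :
    Set E :=
  {z | (fun x : E => x ^ p - algebraMap K E c)^[m] z = algebraMap K E a}

variable {p : ℕ} {K E : Type*} [Field K] [Field E] [Algebra K E] {a c : K}

theorem preimages_eq_levelSet (m : ℕ) :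
    preimages E (Polynomial.X ^ p - Polynomial.C c) a m = levelSet p E a c m := by
  simp [preimages, levelSet]

theorem map_mem_levelSet_iff {E' : Type*} [Field E'] [Algebra K E'] (φ : E →ₐ[K] E') {m : ℕ}
    {z : E} : φ z ∈ levelSet p E' a c m ↔ z ∈ levelSet p E a c m := by
  have h1 : Function.Semiconj φ (fun x : E => x ^ p - algebraMap K E c)
      (fun x : E' => x ^ p - algebraMap K E' c) := fun x => by
    rw [map_sub, map_pow, φ.commutes]
  have h2 := (h1.iterate_right m).eq z
  change _ = _ ↔ _ = _
  rw [← h2, ← φ.commutes a]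
  exact φ.injective.eq_iff

theorem aut_mem_levelSet (σ : Gal(E/K)) {m : ℕ} {z : E} (hz : z ∈ levelSet p E a c m) :
    σ z ∈ levelSet p E a c m :=
  (map_mem_levelSet_iff (σ : E →ₐ[K] E)).2 hz

theorem finite_levelSet_and_ncard_le (hp : p ≠ 0) (m : ℕ) :
    (levelSet p E a c m).Finite ∧ (levelSet p E a c m).ncard ≤ p ^ m := by
  classical
  let g : Polynomial E := Polynomial.X ^ p - Polynomial.C (algebraMap K E c)
  have hg : g.natDegree = p := Polynomial.natDegree_X_pow_sub_C
  let Q : Polynomial E := g.comp^[m] Polynomial.X - Polynomial.C (algebraMap K E a)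
  have hQ : Q.natDegree = p ^ m := by
    rw [Polynomial.natDegree_sub_C, Polynomial.natDegree_iterate_comp, hg,
      Polynomial.natDegree_X, mul_one]
  have hQ0 : Q ≠ 0 := by
    intro h
    rw [h, Polynomial.natDegree_zero] at hQ
    exact pow_ne_zero m hp hQ.symm
  have hsub : levelSet p E a c m ⊆ (Q.roots.toFinset : Set E) := by
    intro z hz
    rw [Finset.mem_coe, Multiset.mem_toFinset, Polynomial.mem_roots hQ0, Polynomial.IsRoot.def,
      Polynomial.eval_sub, Polynomial.iterate_comp_eval, Polynomial.eval_C, Polynomial.eval_X,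
      sub_eq_zero]
    change _ = _ at hz
    simpa [g] using hz
  refine ⟨(Finset.finite_toSet _).subset hsub, ?_⟩
  calc (levelSet p E a c m).ncard ≤ (Q.roots.toFinset : Set E).ncard :=
        Set.ncard_le_ncard hsub (Finset.finite_toSet _)
    _ = Q.roots.toFinset.card := Set.ncard_coe_finset _
    _ ≤ p ^ m := (Multiset.toFinset_card_le _).trans (Q.card_roots'.trans hQ.le)

variable (p E a c) in
/-- Every element of `E` is fixed by the automorphisms that fix the levels of the tree up to a
certain height. This holds when `E` is generated by a set of points of the tree. -/
def GeneratedByLevels : Prop :=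
  ∀ x : E, ∃ M, ∀ σ : Gal(E/K), (∀ m ≤ M, ∀ z ∈ levelSet p E a c m, σ z = z) → σ x = x

theorem generatedByLevels_adjoin {L : Type*} [Field L] [Algebra K L] {S : Set L}
    (hS : ∀ s ∈ S, ∃ m, s ∈ levelSet p L a c m) :
    GeneratedByLevels p (IntermediateField.adjoin K S) a c := by
  rintro ⟨x, hx⟩
  induction hx using IntermediateField.adjoin_induction with
  | mem x hx =>
    obtain ⟨m, hm⟩ := hS x hx
    exact ⟨m, fun σ hσ => hσ m le_rfl _
      ((map_mem_levelSet_iff (IntermediateField.adjoin K S).val).1 hm)⟩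
  | algebraMap x => exact ⟨0, fun σ _ => σ.commutes x⟩
  | add x y hx hy h₁ h₂ =>
    obtain ⟨M₁, h₁⟩ := h₁
    obtain ⟨M₂, h₂⟩ := h₂
    refine ⟨max M₁ M₂, fun σ hσ => ?_⟩
    have e₁ := h₁ σ fun m hm => hσ m (hm.trans (le_max_left _ _))
    have e₂ := h₂ σ fun m hm => hσ m (hm.trans (le_max_right _ _))
    exact (map_add σ ⟨x, hx⟩ ⟨y, hy⟩).trans (congrArg₂ _ e₁ e₂)
  | inv x hx h =>
    obtain ⟨M, h⟩ := h
    exact ⟨M, fun σ hσ => (map_inv₀ σ ⟨x, hx⟩).trans (congrArg _ (h σ hσ))⟩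
  | mul x y hx hy h₁ h₂ =>
    obtain ⟨M₁, h₁⟩ := h₁
    obtain ⟨M₂, h₂⟩ := h₂
    refine ⟨max M₁ M₂, fun σ hσ => ?_⟩
    have e₁ := h₁ σ fun m hm => hσ m (hm.trans (le_max_left _ _))
    have e₂ := h₂ σ fun m hm => hσ m (hm.trans (le_max_right _ _))
    exact (map_mul σ ⟨x, hx⟩ ⟨y, hy⟩).trans (congrArg₂ _ e₁ e₂)

theorem eq_one_of_forall_levelSet (hE : GeneratedByLevels p E a c) {σ : Gal(E/K)}
    (hσ : ∀ m, ∀ z ∈ levelSet p E a c m, σ z = z) : σ = 1 := by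
  ext x
  obtain ⟨M, hM⟩ := hE x
  exact hM σ fun m _ => hσ m

/-- An automorphism that fixes the `p`-th roots of unity acts on level `m` with order dividing
`p ^ m`: by induction it multiplies, after raising to a power, a root of `X ^ p - (y + c)` by a
`p`-th root of unity. -/
theorem pow_apply_levelSet {σ : Gal(E/K)}
    (hσ : ∀ η : E, η ^ p = 1 → σ η = η) (m : ℕ) {z : E} (hz : z ∈ levelSet p E a c m) :
    (σ ^ p ^ m) z = z := by
  induction m generalizing z with
  | zero =>
    have : z = algebraMap K E a := hz
    rw [this]
    exact AlgEquiv.commutes _ a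
  | succ m ih =>
    change (fun x : E => x ^ p - algebraMap K E c)^[m + 1] z = algebraMap K E a at hz
    rw [Function.iterate_succ_apply] at hz
    have h1 := ih hz
    set τ := σ ^ p ^ m with hτ
    rw [map_sub, AlgEquiv.commutes, map_pow, sub_left_inj] at h1
    rw [pow_succ, pow_mul, ← hτ]
    rcases eq_or_ne z 0 with rfl | hz0
    · exact map_zero _
    have hη : (τ z / z) ^ p = 1 := by
      rw [div_pow, h1, div_self (pow_ne_zero _ hz0)]
    have hτη : τ (τ z / z) = τ z / z := by
      have h2 : σ ∈ MulAction.stabilizer Gal(E/K) (τ z / z) := hσ _ hη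
      exact Subgroup.pow_mem _ h2 (p ^ m)
    have h3 : τ z = τ z / z * z := (div_mul_cancel₀ _ hz0).symm
    have key : ∀ n : ℕ, (τ ^ n) z = (τ z / z) ^ n * z := by
      intro n
      induction n with
      | zero => simp
      | succ n ihn =>
        rw [pow_succ', AlgEquiv.mul_apply, ihn, map_mul, map_pow, hτη, pow_succ, mul_assoc, ← h3]
    rw [key, hη, one_mul]

theorem exists_pow_apply_eq (hE : GeneratedByLevels p E a c) {σ : Gal(E/K)}
    (hσ : ∀ η : E, η ^ p = 1 → σ η = η) (x : E) : ∃ k, (σ ^ p ^ k) x = x := by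
  obtain ⟨M, hM⟩ := hE x
  refine ⟨M, hM _ fun m hm z hz => ?_⟩
  have h2 : σ ^ p ^ m ∈ MulAction.stabilizer Gal(E/K) z := pow_apply_levelSet hσ m hz
  have h3 := Subgroup.pow_mem _ h2 (p ^ (M - m))
  rw [← pow_mul, ← pow_add, Nat.add_sub_cancel' hm] at h3
  exact h3

theorem isOpen_fixing_levels (hp : p ≠ 0) [Algebra.IsIntegral K E] (M : ℕ) :
    IsOpen {σ : Gal(E/K) | ∀ m ≤ M, ∀ z ∈ levelSet p E a c m, σ z = z} := by
  have h1 : {σ : Gal(E/K) | ∀ m ≤ M, ∀ z ∈ levelSet p E a c m, σ z = z} =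
      ⋂ m ∈ Set.Iic M, ⋂ z ∈ levelSet p E a c m, {σ : Gal(E/K) | σ z = z} := by
    ext σ; simp
  rw [h1]
  exact (Set.finite_Iic M).isOpen_biInter fun m _ =>
    (finite_levelSet_and_ncard_le hp m).1.isOpen_biInter fun z _ =>
      isOpen_setOf_apply z fun y => y = z

theorem exists_fixing_levels_subset (hE : GeneratedByLevels p E a c) {U : Set Gal(E/K)}
    (hU : IsOpen U) (h1U : 1 ∈ U) :
    ∃ M, ∀ σ : Gal(E/K), (∀ m ≤ M, ∀ z ∈ levelSet p E a c m, σ z = z) → σ ∈ U := by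
  obtain ⟨T, hT, hTN⟩ := (krullTopology_mem_nhds_one_iff K E _).1 (hU.mem_nhds h1U)
  let b := Module.finBasis K T
  choose k hk using fun i => hE (b i)
  obtain ⟨M, hM⟩ := (Set.finite_range k).bddAbove
  refine ⟨M, fun σ hσ => hTN fun x => ?_⟩
  change σ (x : E) = x
  have hb : ∀ i, σ (b i) = b i := fun i =>
    hk i σ fun m hm => hσ m (hm.trans (hM ⟨i, rfl⟩))
  have hx := congrArg (T.val) (b.sum_repr x)
  rw [map_sum] at hx
  simp only [map_smul] at hx
  change _ = (x : E) at hx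
  rw [← hx, map_sum]
  refine Finset.sum_congr rfl fun i _ => ?_
  rw [map_smul]
  exact congrArg _ (hb i)

theorem limitField_eq_adjoin (Kbar : Type*) [Field Kbar] [Algebra K Kbar] (a c : K) :
    limitField Kbar (Polynomial.X ^ p - Polynomial.C c) a =
      IntermediateField.adjoin K (⋃ n, levelSet p Kbar a c n) := by
  rw [IntermediateField.adjoin_iUnion]
  exact iSup_congr fun n => by rw [← preimages_eq_levelSet]; rfl

theorem normal_limitField (Kbar : Type*) [Field Kbar] [Algebra K Kbar] [Normal K Kbar] (a c : K) :
    Normal K (limitField Kbar (Polynomial.X ^ p - Polynomial.C c) a) := by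
  rw [limitField_eq_adjoin]
  rw [IntermediateField.normal_iff_forall_map_le]
  intro φ
  rw [IntermediateField.adjoin_map, IntermediateField.adjoin_le_iff]
  rintro _ ⟨z, hz, rfl⟩
  obtain ⟨n, hn⟩ := Set.mem_iUnion.1 hz
  exact IntermediateField.subset_adjoin K _
    (Set.mem_iUnion.2 ⟨n, (map_mem_levelSet_iff φ).2 hn⟩)

theorem mem_limitField {Kbar : Type*} [Field Kbar] [Algebra K Kbar] {m : ℕ} {z : Kbar}
    (hz : z ∈ levelSet p Kbar a c m) :
    z ∈ limitField Kbar (Polynomial.X ^ p - Polynomial.C c) a := by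
  rw [limitField_eq_adjoin]
  exact IntermediateField.subset_adjoin K _ (Set.mem_iUnion.2 ⟨m, hz⟩)

theorem generatedByLevels_limitField (Kbar : Type*) [Field Kbar] [Algebra K Kbar] (a c : K) :
    GeneratedByLevels p (limitField Kbar (Polynomial.X ^ p - Polynomial.C c) a) a c := by
  rw [limitField_eq_adjoin]
  exact generatedByLevels_adjoin fun s hs => Set.mem_iUnion.1 hs

theorem generatedByLevels_levelField (Kbar : Type*) [Field Kbar] [Algebra K Kbar] (a c : K)
    (n : ℕ) :
    GeneratedByLevels p (levelField Kbar (Polynomial.X ^ p - Polynomial.C c) a n) a c := by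
  unfold levelField
  rw [preimages_eq_levelSet]
  exact generatedByLevels_adjoin fun s hs => ⟨n, hs⟩

theorem finiteDimensional_levelField (hp : p ≠ 0) (Kbar : Type*) [Field Kbar] [Algebra K Kbar]
    [Algebra.IsIntegral K Kbar] (a c : K) (n : ℕ) :
    FiniteDimensional K (levelField Kbar (Polynomial.X ^ p - Polynomial.C c) a n) := by
  unfold levelField
  rw [preimages_eq_levelSet]
  have : Finite (levelSet p Kbar a c n) := (finite_levelSet_and_ncard_le hp n).1
  exact IntermediateField.finiteDimensional_adjoin fun x _ => Algebra.IsIntegral.isIntegral x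

end Levels

section InertiaOnLevels

variable {p : ℕ} [hp : Fact p.Prime] {K E : Type*} [Field K] [Field E] [Algebra K E]
  [Algebra ℚ_[p] E] [Algebra.IsAlgebraic ℚ_[p] E] {I : Subgroup Gal(E/K)} {a c : K} {β : ℝ≥0}

/-- The base field contains an element `t` of the same size as `1 / (ζ - 1)`, so that inertia, which
acts trivially on the residue class of `(ζ - 1) t`, fixes `ζ`. -/
theorem inertia_fixes_roots_of_unity (hI : IsInertia p I) (hβ : β ^ (p - 1) = p) {t : K}
    (ht : absVal p E (algebraMap K E t) = β) {σ : Gal(E/K)} (hσ : σ ∈ I) {η : E}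
    (hη : η ^ p = 1) : σ η = η := by
  have hvp := absVal_natCast_prime p (L := E)
  have hβ0 : β ≠ 0 := (zero_lt_one.trans (one_lt_of_pow_pred_eq hβ)).ne'
  set T := algebraMap K E t with hT
  have hT0 : T ≠ 0 := by
    rw [← (absVal p E).ne_zero_iff, ht]; exact hβ0
  have hval : ∀ ξ : E, ξ ^ p = 1 → absVal p E (ξ * T) = β := by
    intro ξ hξ
    have h1 : absVal p E ξ ^ p = 1 := by rw [← map_pow, hξ, map_one]
    rw [map_mul, ht, (pow_eq_one_iff_of_nonneg zero_le hp.out.ne_zero).1 h1, one_mul]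
  have hle : absVal p E (η * T - T) ≤ 1 := by
    by_cases h : η * T = T
    · rw [h, sub_self, map_zero]; exact zero_le
    · exact (val_sub_eq_one_of_pow _ hvp hβ ht h
        (Or.inl (by rw [mul_pow, hη, one_mul]))).le
  have h1 := (hI σ).1 hσ _ hle
  have hσT : σ T = T := σ.commutes t
  rw [map_sub σ, map_mul, hσT, sub_sub_sub_cancel_right] at h1
  by_contra hne
  have hση : σ η ^ p = 1 := by rw [← map_pow, hη, map_one]
  have h2 := val_sub_eq_one_of_pow _ hvp hβ (hval η hη)
    (fun h => hne (mul_right_cancel₀ hT0 h)) (Or.inl (by rw [mul_pow, mul_pow, hση, hη]))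
  exact absurd h2 h1.ne

/-- Points of one level over a point `a` with `v(a) > v(c)` are equal if they are congruent. -/
theorem eq_of_levelSet_of_lt (hβ : β ^ (p - 1) = p)
    (hc : absVal p E (algebraMap K E c) = β ^ p)
    (ha : absVal p E (algebraMap K E a) < β ^ p) {m : ℕ} {z z' : E} (hz : z ∈ levelSet p E a c m)
    (hz' : z' ∈ levelSet p E a c m) (h : absVal p E (z - z') < 1) : z = z' := by
  by_contra hne
  exact absurd (val_sub_eq_one_of_iterate _ (absVal_natCast_prime p) hβ hc ha m hz hz' hne) h.ne

theorem absVal_sub_le_one_of_levelSet (hβ : β ^ (p - 1) = p)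
    (hc : absVal p E (algebraMap K E c) = β ^ p)
    (ha : absVal p E (algebraMap K E a) < β ^ p) {m : ℕ} {z z' : E} (hz : z ∈ levelSet p E a c m)
    (hz' : z' ∈ levelSet p E a c m) : absVal p E (z - z') ≤ 1 := by
  rcases eq_or_ne z z' with rfl | hne
  · simp
  · exact (val_sub_eq_one_of_iterate _ (absVal_natCast_prime p) hβ hc ha m hz hz' hne).le

/-- Inertia acts on each level through translations of the residue field, hence freely. -/
theorem inertia_free_on_levelSet (hβ : β ^ (p - 1) = p)
    (hc : absVal p E (algebraMap K E c) = β ^ p)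
    (ha : absVal p E (algebraMap K E a) < β ^ p) (hI : IsInertia p I)
    {σ : Gal(E/K)} (hσ : σ ∈ I) {m : ℕ} {z z' : E} (hz : z ∈ levelSet p E a c m)
    (hz' : z' ∈ levelSet p E a c m) (h : σ z = z) : σ z' = z' := by
  refine eq_of_levelSet_of_lt hβ hc ha (aut_mem_levelSet σ hz') hz' ?_
  have h1 := (hI σ).1 hσ _ (absVal_sub_le_one_of_levelSet hβ hc ha hz' hz)
  rwa [map_sub σ, h, sub_sub_sub_cancel_right] at h1

theorem inertia_comm_on_levelSet (hβ : β ^ (p - 1) = p)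
    (hc : absVal p E (algebraMap K E c) = β ^ p)
    (ha : absVal p E (algebraMap K E a) < β ^ p) (hI : IsInertia p I)
    {σ τ : Gal(E/K)} (hσ : σ ∈ I) (hτ : τ ∈ I) {m : ℕ} {z : E}
    (hz : z ∈ levelSet p E a c m) : σ (τ z) = τ (σ z) := by
  refine eq_of_levelSet_of_lt hβ hc ha (aut_mem_levelSet σ (aut_mem_levelSet τ hz))
    (aut_mem_levelSet τ (aut_mem_levelSet σ hz)) ?_
  have h1 := (hI σ).1 hσ _ (absVal_sub_le_one_of_levelSet hβ hc ha (aut_mem_levelSet τ hz) hz)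
  have h2 := (hI τ).1 hτ _ (absVal_sub_le_one_of_levelSet hβ hc ha (aut_mem_levelSet σ hz) hz)
  rw [map_sub σ] at h1
  rw [map_sub τ] at h2
  have h3 : σ (τ z) - τ (σ z) = (σ (τ z) - σ z - (τ z - z)) - (τ (σ z) - τ z - (σ z - z)) := by
    ring
  rw [h3]
  exact (absVal p E).map_sub_lt h1 h2

theorem inertia_pow_prime_on_levelSet (hβ : β ^ (p - 1) = p)
    (hc : absVal p E (algebraMap K E c) = β ^ p)
    (ha : absVal p E (algebraMap K E a) < β ^ p) (hI : IsInertia p I) {σ : Gal(E/K)} (hσ : σ ∈ I)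
    {m : ℕ} {z : E} (hz : z ∈ levelSet p E a c m) : (σ ^ p) z = z := by
  refine eq_of_levelSet_of_lt hβ hc ha (aut_mem_levelSet _ hz) hz ?_
  have hu := absVal_sub_le_one_of_levelSet hβ hc ha (aut_mem_levelSet σ hz) hz
  have key : ∀ n : ℕ, absVal p E ((σ ^ n) z - z - n * (σ z - z)) < 1 := by
    intro n
    induction n with
    | zero => simp
    | succ n ih =>
      have h1 := (hI σ).1 hσ _
        (absVal_sub_le_one_of_levelSet hβ hc ha (aut_mem_levelSet (σ ^ n) hz) hz)
      rw [map_sub σ] at h1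
      have h2 : (σ ^ (n + 1)) z - z - ((n + 1 : ℕ) : E) * (σ z - z) =
          (σ ((σ ^ n) z) - σ z - ((σ ^ n) z - z)) + ((σ ^ n) z - z - n * (σ z - z)) := by
        rw [pow_succ', AlgEquiv.mul_apply]
        push_cast
        ring
      rw [h2]
      exact (absVal p E).map_add_lt h1 ih
  have h1 := key p
  have h2 : absVal p E ((p : E) * (σ z - z)) < 1 := by
    rw [map_mul, absVal_natCast_prime]
    refine mul_lt_one_of_nonneg_of_lt_one_left zero_le ?_ hu
    exact inv_lt_one_of_one_lt₀ (by exact_mod_cast hp.out.one_lt)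
  rw [← sub_add_cancel ((σ ^ p) z - z) ((p : E) * (σ z - z))]
  exact (absVal p E).map_add_lt h1 h2

theorem isElementaryAbelian_inertia (hβ : β ^ (p - 1) = p)
    (hc : absVal p E (algebraMap K E c) = β ^ p)
    (ha : absVal p E (algebraMap K E a) < β ^ p) (hI : IsInertia p I)
    (hE : GeneratedByLevels p E a c) :
    IsElementaryAbelian p I := by
  refine ⟨fun σ τ => ?_, fun σ => ?_⟩
  · have h1 : (σ * τ * (τ * σ)⁻¹ : Gal(E/K)) = 1 := by
      refine eq_one_of_forall_levelSet hE fun m z hz => ?_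
      have h2 := inertia_comm_on_levelSet hβ hc ha hI σ.2 τ.2
        (aut_mem_levelSet ((τ * σ : Gal(E/K))⁻¹) hz)
      refine h2.trans ?_
      exact AlgEquiv.apply_symm_apply (τ.1 * σ.1) z
    exact Subtype.ext (mul_inv_eq_one.1 h1)
  · exact Subtype.ext (eq_one_of_forall_levelSet hE fun m z hz =>
      inertia_pow_prime_on_levelSet hβ hc ha hI σ.2 hz)

/-- If the points of the tree over a point `a` with `v(a) > v(c)` differ from `a` by integers, then
inertia is trivial. -/
theorem inertia_eq_bot_of_integral (hβ : β ^ (p - 1) = p)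
    (hc : absVal p E (algebraMap K E c) = β ^ p)
    (ha : absVal p E (algebraMap K E a) < β ^ p) (hI : IsInertia p I)
    (hE : GeneratedByLevels p E a c)
    (hint : ∀ m, ∀ z ∈ levelSet p E a c m, absVal p E (z - algebraMap K E a) ≤ 1) : I = ⊥ := by
  rw [eq_bot_iff]
  intro σ hσ
  refine eq_one_of_forall_levelSet hE fun m z hz => ?_
  refine eq_of_levelSet_of_lt hβ hc ha (aut_mem_levelSet σ hz) hz ?_
  have h1 := (hI σ).1 hσ _ (hint m z hz)
  rwa [map_sub σ, σ.commutes, sub_sub_sub_cancel_right] at h1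

end InertiaOnLevels

/-! ### The profinite topology on inertia and its quotient -/

theorem isProP_of_isClosed {p : ℕ} [Fact p.Prime] {K E : Type*} [Field K] [Field E] [Algebra K E]
    [IsGalois K E] {I : Subgroup Gal(E/K)} (hI : IsClosed (I : Set Gal(E/K)))
    (hpt : ∀ σ ∈ I, ∀ x : E, ∃ k, (σ ^ p ^ k) x = x) : IsProP p I := by
  have hcomp : CompactSpace I := isCompact_iff_compactSpace.1 hI.isCompact
  refine ⟨inferInstance, hcomp, inferInstance, inferInstance, fun N hN hNo => ?_⟩
  obtain ⟨U, hU, hUN⟩ := isOpen_induced_iff.1 hNo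
  have h1 : (1 : Gal(E/K)) ∈ U := by
    have : (1 : I) ∈ Subtype.val ⁻¹' U := by rw [hUN]; exact N.one_mem
    exact this
  have := Subgroup.quotient_finite_of_isOpen N hNo
  have hP : IsPGroup p (I ⧸ N) := by
    intro q
    obtain ⟨σ, rfl⟩ := QuotientGroup.mk_surjective q
    obtain ⟨k, hk⟩ := exists_pow_mem_of_isOpen (hpt σ.1 σ.2) hU h1
    refine ⟨k, ?_⟩
    rw [← QuotientGroup.mk_pow, QuotientGroup.eq_one_iff, ← SetLike.mem_coe, ← hUN]
    exact hk
  exact IsPGroup.iff_card.1 hP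

section TopologyOfInertia

variable {p : ℕ} [hp : Fact p.Prime] {K E : Type*} [Field K] [Field E] [Algebra K E]
  [Algebra ℚ_[p] E] [Algebra.IsAlgebraic ℚ_[p] E] {I : Subgroup Gal(E/K)}

/-- The action on residue classes separates the points of `Aut(E/K)/I`. -/
theorem totallySeparatedSpace_quotient_inertia [Algebra ℚ_[p] K] [IsScalarTower ℚ_[p] K E]
    [Algebra.IsIntegral K E] (hI : IsInertia p I) : TotallySeparatedSpace (Gal(E/K) ⧸ I) := by
  rw [totallySeparatedSpace_iff_exists_isClopen]
  intro q q' hne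
  obtain ⟨δ, rfl⟩ := QuotientGroup.mk_surjective q
  obtain ⟨ε, rfl⟩ := QuotientGroup.mk_surjective q'
  have hcongr : ∀ (σ τ : Gal(E/K)) (x : E), absVal p E ((σ⁻¹ * τ) x - x) < 1 ↔
      absVal p E (τ x - σ x) < 1 := by
    intro σ τ x
    rw [← absVal_aut σ, map_sub]
    have : σ ((σ⁻¹ * τ) x) = τ x := AlgEquiv.apply_symm_apply σ (τ x)
    rw [this]
  have h1 : δ⁻¹ * ε ∉ I := fun h => hne (QuotientGroup.eq.2 h)
  rw [hI] at h1
  push Not at h1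
  obtain ⟨x, hx, hxv⟩ := h1
  let A : Set Gal(E/K) := {σ | absVal p E (σ x - δ x) < 1}
  have hpre : (QuotientGroup.mk ⁻¹' (QuotientGroup.mk '' A : Set (Gal(E/K) ⧸ I))) = A := by
    refine Set.Subset.antisymm ?_ (Set.subset_preimage_image _ _)
    rintro σ ⟨τ, hτ, hτσ⟩
    have h2 := (hI _).1 (QuotientGroup.eq.1 hτσ) x hx
    exact val_sub_lt_one_trans _ ((hcongr τ σ x).1 h2) hτ
  have hA : IsClopen A := by
    refine ⟨?_, isOpen_setOf_apply x fun y => absVal p E (y - δ x) < 1⟩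
    rw [← isOpen_compl_iff]
    exact isOpen_setOf_apply x fun y => ¬ absVal p E (y - δ x) < 1
  refine ⟨QuotientGroup.mk '' A, ?_, ⟨δ, ?_, rfl⟩, ?_⟩
  · rw [← (QuotientGroup.isQuotientMap_mk I).isClopen_preimage, hpre]
    exact hA
  · change absVal p E (δ x - δ x) < 1
    simp
  · intro h
    have h2 : ε ∈ A := by rw [← hpre]; exact h
    exact absurd ((hcongr δ ε x).2 h2) (not_lt.2 hxv)

theorem nonempty_inertia_continuousMulEquiv_pi [IsGalois K E] {a c : K} (hI : IsInertia p I)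
    [Infinite I] (hel : IsElementaryAbelian p I) (hE : GeneratedByLevels p E a c) :
    Nonempty (I ≃ₜ* Multiplicative (ℕ → ZMod p)) := by
  have hcl := isClosed_inertia hI
  have hcomp : CompactSpace I := isCompact_iff_compactSpace.1 hcl.isCompact
  let _ : CommGroup I := { (inferInstance : Group I) with mul_comm := hel.1 }
  let N : ℕ → Subgroup I := fun M =>
    { carrier := {σ | ∀ m ≤ M, ∀ z ∈ levelSet p E a c m, σ.1 z = z}
      one_mem' := fun m _ z _ => rfl
      mul_mem' := fun {σ τ} hσ hτ m hm z hz => by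
        change σ.1 (τ.1 z) = z
        rw [hτ m hm z hz, hσ m hm z hz]
      inv_mem' := fun {σ} hσ m hm z hz => by
        change σ.1⁻¹ z = z
        have h1 : σ.1⁻¹ (σ.1 z) = z := AlgEquiv.symm_apply_apply σ.1 z
        rwa [hσ m hm z hz] at h1 }
  refine nonempty_continuousMulEquiv_pi_zmod p hel.2 N (fun M => ?_) fun U hU h1U => ?_
  · exact (isOpen_fixing_levels (K := K) (E := E) (a := a) (c := c) hp.out.ne_zero M).preimage
      continuous_subtype_val
  · obtain ⟨W, hW, rfl⟩ := isOpen_induced_iff.1 hU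
    obtain ⟨M, hM⟩ := exists_fixing_levels_subset hE hW h1U
    exact ⟨M, fun σ hσ => hM σ.1 hσ⟩

/-- The quotient `Aut(E/K)/I` is isomorphic to `ℤ_p` if the `p`-th roots of unity are fixed and the
residue field is infinite. -/
theorem nonempty_quotient_inertia_continuousMulEquiv [Algebra ℚ_[p] K] [IsScalarTower ℚ_[p] K E]
    [FiniteDimensional ℚ_[p] K] [IsGalois K E] [I.Normal] (hI : IsInertia p I)
    (hpt : ∀ (σ : Gal(E/K)) (x : E), ∃ k, (σ ^ p ^ k) x = x)
    (hres : ∀ n : ℕ, ∃ S : Finset E, n < S.card ∧ (∀ x ∈ S, absVal p E x ≤ 1) ∧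
      ∀ x ∈ S, ∀ y ∈ S, x ≠ y → absVal p E (x - y) = 1) :
    Nonempty ((Gal(E/K) ⧸ I) ≃ₜ* Multiplicative ℤ_[p]) := by
  have := totallySeparatedSpace_quotient_inertia hI
  have := infinite_quotient_inertia hI (fun σ _ => hpt σ) hres
  have hopen : ∀ N : Subgroup (Gal(E/K) ⧸ I), IsOpen (N : Set (Gal(E/K) ⧸ I)) →
      IsOpen ((N.comap (QuotientGroup.mk' I) : Subgroup Gal(E/K)) : Set Gal(E/K)) :=
    fun N hN => hN.preimage QuotientGroup.continuous_mk
  refine nonempty_continuousMulEquiv_padicInt p (fun N _ hNo => ?_) fun N _ hNo δ => ?_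
  · obtain ⟨γ, hγ⟩ := exists_generator_mod_open hI (hopen N hNo) fun σ hσ => by
      rw [Subgroup.mem_comap, QuotientGroup.mk'_apply, (QuotientGroup.eq_one_iff σ).2 hσ]
      exact N.one_mem
    refine ⟨QuotientGroup.mk γ, fun δ => ?_⟩
    obtain ⟨δ, rfl⟩ := QuotientGroup.mk_surjective δ
    exact hγ δ
  · obtain ⟨δ, rfl⟩ := QuotientGroup.mk_surjective δ
    exact exists_pow_mem_of_isOpen (hpt δ) (hopen N hNo) (Subgroup.one_mem _)

end TopologyOfInertia

section IntermediateFields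

variable {p : ℕ} [hp : Fact p.Prime] {K Kbar : Type*} [Field K] [Algebra ℚ_[p] K] [Field Kbar]
  [Algebra K Kbar] [Algebra ℚ_[p] Kbar] [IsScalarTower ℚ_[p] K Kbar]

theorem isAlgebraic_intermediateField [Algebra.IsAlgebraic ℚ_[p] Kbar]
    (E : IntermediateField K Kbar) : Algebra.IsAlgebraic ℚ_[p] E :=
  Algebra.IsAlgebraic.of_injective (E.val.restrictScalars ℚ_[p]) Subtype.val_injective

theorem absVal_coe [Algebra.IsAlgebraic ℚ_[p] Kbar] (E : IntermediateField K Kbar)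
    [Algebra.IsAlgebraic ℚ_[p] E] (x : E) : absVal p E x = absVal p Kbar (x : Kbar) := by
  have h : minpoly ℚ_[p] (x : Kbar) = minpoly ℚ_[p] x :=
    minpoly.algHom_eq (E.val.restrictScalars ℚ_[p]) Subtype.val_injective x
  apply Subtype.ext
  change spectralValue (minpoly ℚ_[p] x) = spectralValue (minpoly ℚ_[p] (x : Kbar))
  rw [h]

theorem isInertia_inertia [FiniteDimensional ℚ_[p] K] [IsAlgClosure K Kbar]
    [Algebra.IsAlgebraic ℚ_[p] Kbar] (E : IntermediateField K Kbar)
    [Algebra.IsAlgebraic ℚ_[p] E] : IsInertia p (inertia p E) := by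
  intro σ
  change (∀ x : E, 0 ≤ val p (x : Kbar) → 0 < val p ((σ x : Kbar) - (x : Kbar))) ↔ _
  refine forall_congr' fun x => ?_
  rw [val_nonneg_iff, val_pos_iff, absVal_coe, absVal_coe]
  rfl

end IntermediateFields

section Normalization

variable (p : ℕ) [hp : Fact p.Prime] {L : Type*} [Field L] [Algebra ℚ_[p] L]
  [Algebra.IsAlgebraic ℚ_[p] L]

/-- In multiplicative terms, `v(c) = -p/(p-1)` says `|c| = β ^ p`, where `β = p ^ (1/(p-1))`. -/
theorem exists_absVal_eq_pow {c : L}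
    (hc : val p c = ((-(p : ℝ) / ((p : ℝ) - 1) : ℝ) : WithTop ℝ)) :
    ∃ β : ℝ≥0, β ^ (p - 1) = p ∧ absVal p L c = β ^ p := by
  have hp1 := one_lt_cast p
  have hp0 : (p : ℝ) - 1 ≠ 0 := (sub_pos.2 hp1).ne'
  refine ⟨(p : ℝ≥0) ^ (1 / ((p : ℝ) - 1)), ?_, ?_⟩
  · rw [← NNReal.rpow_natCast, ← NNReal.rpow_mul, Nat.cast_sub hp.out.one_lt.le, Nat.cast_one,
      one_div, inv_mul_cancel₀ hp0, NNReal.rpow_one]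
  · unfold val at hc
    split_ifs at hc with h0
    · exact absurd hc (WithTop.top_ne_coe)
    · have h1 := WithTop.coe_injective hc
      have hpos : 0 < spectralNorm ℚ_[p] L c :=
        spectralNorm_zero_lt h0 (Algebra.IsAlgebraic.isAlgebraic c)
      have h2 : Real.logb p (spectralNorm ℚ_[p] L c) = (p : ℝ) / ((p : ℝ) - 1) := by
        rw [neg_div] at h1
        exact neg_injective h1
      apply NNReal.coe_injective
      rw [coe_absVal, ← Real.rpow_logb (zero_lt_one.trans hp1) hp1.ne' hpos, h2,
        ← NNReal.rpow_natCast, ← NNReal.rpow_mul, NNReal.coe_rpow, NNReal.coe_natCast]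
      congr 1
      rw [one_div, inv_mul_eq_div]

theorem absVal_lt_of_val_lt {a c : L} (hc : c ≠ 0) (h : val p c < val p a) :
    absVal p L a < absVal p L c := by
  by_cases ha : a = 0
  · rw [ha, map_zero]
    exact zero_lt_iff.2 ((absVal p L).ne_zero_iff.2 hc)
  · unfold val at h
    rw [if_neg ha, if_neg hc, WithTop.coe_lt_coe, neg_lt_neg_iff,
      Real.logb_lt_logb_iff (one_lt_cast p)
        (spectralNorm_zero_lt ha (Algebra.IsAlgebraic.isAlgebraic a))
        (spectralNorm_zero_lt hc (Algebra.IsAlgebraic.isAlgebraic c))] at h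
    exact h

end Normalization

/-! ### The fields generated by the levels -/

section Conclusion

theorem fixes_roots_of_isPrimitiveRoot {p : ℕ} [NeZero p] {K E : Type*} [Field K] [Field E]
    [Algebra K E] (h : ∃ ζ : K, IsPrimitiveRoot ζ p) (σ : Gal(E/K)) (η : E) (hη : η ^ p = 1) :
    σ η = η := by
  obtain ⟨ζ, hζ⟩ := h
  obtain ⟨i, -, rfl⟩ := (hζ.map_of_injective (algebraMap K E).injective).eq_pow_of_pow_eq_one hη
  rw [map_pow, σ.commutes]

/-- A group of automorphisms of a finite extension generated by points of the tree is a `p`-group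
if it fixes the `p`-th roots of unity. -/
theorem isPGroup_of_fixes_roots {p : ℕ} {K E : Type*} [Field K] [Field E] [Algebra K E]
    [FiniteDimensional K E] {a c : K} (hE : GeneratedByLevels p E a c) {I : Subgroup Gal(E/K)}
    (h : ∀ σ ∈ I, ∀ η : E, η ^ p = 1 → σ η = η) : IsPGroup p I := by
  intro σ
  obtain ⟨k, hk⟩ := exists_pow_mem_of_isOpen (U := {1})
    (fun x => exists_pow_apply_eq hE (h σ.1 σ.2) x) (isOpen_discrete _) rfl
  exact ⟨k, Subtype.ext hk⟩

variable {p : ℕ} [hp : Fact p.Prime] {K Kbar : Type*} [Field K] [Algebra ℚ_[p] K]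
  [Field Kbar] [Algebra K Kbar] [Algebra ℚ_[p] Kbar]
  [IsScalarTower ℚ_[p] K Kbar] [IsAlgClosure K Kbar] [Algebra.IsAlgebraic ℚ_[p] Kbar]
  {a c : K} {β : ℝ≥0}

/-- If `v(a - b) < 0`, then all `p ^ n`-th roots of `|a - b|` occur as absolute values on `K_∞`. -/
theorem exists_absVal_pow_eq_limitField (hβ : β ^ (p - 1) = p)
    (hc : absVal p Kbar (algebraMap K Kbar c) = β ^ p) {b : Kbar}
    (hb : b ^ p - algebraMap K Kbar c = b) (hab : 1 < absVal p Kbar (algebraMap K Kbar a - b))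
    [Algebra.IsAlgebraic ℚ_[p] (limitField Kbar (Polynomial.X ^ p - Polynomial.C c) a)] (n : ℕ) :
    ∃ x : limitField Kbar (Polynomial.X ^ p - Polynomial.C c) a,
      absVal p _ x ^ p ^ n = absVal p Kbar (algebraMap K Kbar a - b) := by
  have : IsAlgClosed Kbar := IsAlgClosure.isAlgClosed K
  obtain ⟨z, hz⟩ := exists_iterate_root (p := p) (algebraMap K Kbar c) (algebraMap K Kbar a) (n + 1)
  let z' : limitField Kbar (Polynomial.X ^ p - Polynomial.C c) a := ⟨z, mem_limitField hz⟩
  refine ⟨z' ^ p - algebraMap K _ c - z', ?_⟩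
  rw [absVal_coe]
  exact val_sub_iterate_pow _ (absVal_natCast_prime p) hβ hc hb hab n hz

/-- The residue field of `K_∞` is infinite: far up the tree the points of one level are pairwise
incongruent. -/
theorem exists_finset_incongruent_limitField (hβ : β ^ (p - 1) = p)
    (hc : absVal p Kbar (algebraMap K Kbar c) = β ^ p)
    [Algebra.IsAlgebraic ℚ_[p] (limitField Kbar (Polynomial.X ^ p - Polynomial.C c) a)] (n : ℕ) :
    ∃ S : Finset (limitField Kbar (Polynomial.X ^ p - Polynomial.C c) a), n < S.card ∧
      (∀ x ∈ S, absVal p _ x ≤ 1) ∧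
      ∀ x ∈ S, ∀ y ∈ S, x ≠ y → absVal p _ (x - y) = 1 := by
  classical
  have : IsAlgClosed Kbar := IsAlgClosure.isAlgClosed K
  have : CharZero Kbar := charZero_of_injective_algebraMap (algebraMap ℚ_[p] Kbar).injective
  set E := limitField Kbar (Polynomial.X ^ p - Polynomial.C c) a
  obtain ⟨N, y, hy, hylt⟩ := exists_iterate_root_lt (absVal p Kbar) hβ hc (algebraMap K Kbar a)
  obtain ⟨S, hS, hSy⟩ := exists_finset_iterate_root (absVal p Kbar) hβ hc hylt n
  have hSE : ∀ z ∈ S, z ∈ E := fun z hz => mem_limitField (m := N + n) (by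
    change (fun x : Kbar => x ^ p - algebraMap K Kbar c)^[N + n] z = _
    rw [Function.iterate_add_apply, hSy z hz, hy])
  have hdiff : ∀ z ∈ S, ∀ z' ∈ S, z ≠ z' → absVal p Kbar (z - z') = 1 := fun z hz z' hz' hne =>
    val_sub_eq_one_of_iterate _ (absVal_natCast_prime p) hβ hc hylt n (hSy z hz) (hSy z' hz') hne
  obtain ⟨z₀, hz₀⟩ : S.Nonempty := by
    rw [← Finset.card_pos, hS]; positivity
  -- The points themselves are not integral, but their differences from a fixed one are.
  let g : S → E := fun z => ⟨z, hSE z z.2⟩ - ⟨z₀, hSE z₀ hz₀⟩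
  have hg : Function.Injective g := fun z z' h => by
    have h1 : (⟨z, hSE z z.2⟩ : E) = ⟨z', hSE z' z'.2⟩ := sub_left_inj.1 h
    exact Subtype.ext (congrArg (fun e : E => (e : Kbar)) h1)
  refine ⟨Finset.univ.image g, ?_, ?_, ?_⟩
  · rw [Finset.card_image_of_injective _ hg, Finset.card_univ, Fintype.card_coe, hS]
    exact Nat.lt_two_pow_self
  · intro x hx
    obtain ⟨z, -, rfl⟩ := Finset.mem_image.1 hx
    rw [absVal_coe]
    change absVal p Kbar ((z : Kbar) - z₀) ≤ 1
    by_cases h : (z : Kbar) = z₀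
    · rw [h, sub_self, map_zero]; exact zero_le
    · exact (hdiff z z.2 z₀ hz₀ h).le
  · intro x hx x' hx' hne
    obtain ⟨z, -, rfl⟩ := Finset.mem_image.1 hx
    obtain ⟨z', -, rfl⟩ := Finset.mem_image.1 hx'
    have h1 : g z - g z' = (⟨z, hSE z z.2⟩ : E) - ⟨z', hSE z' z'.2⟩ :=
      sub_sub_sub_cancel_right _ _ _
    rw [h1, absVal_coe]
    exact hdiff z z.2 z' z'.2 fun h => hne (by rw [Subtype.ext h])

variable [FiniteDimensional ℚ_[p] K]

theorem inertia_fixes_roots (hβ : β ^ (p - 1) = p)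
    (hc : absVal p Kbar (algebraMap K Kbar c) = β ^ p) (E : IntermediateField K Kbar)
    {σ : Gal(E/K)} (hσ : σ ∈ inertia p E) (η : E) (hη : η ^ p = 1) : σ η = η := by
  have := isAlgebraic_intermediateField (p := p) E
  -- `|p * c| = β ^ p / p = β`
  refine inertia_fixes_roots_of_unity (isInertia_inertia E) hβ (t := p * c) ?_ hσ hη
  rw [map_mul, map_natCast, map_mul, absVal_natCast_prime, absVal_coe]
  change _ * absVal p Kbar (algebraMap K Kbar c) = β
  have hp0 : (p : ℝ≥0) ≠ 0 := by exact_mod_cast hp.out.ne_zero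
  obtain ⟨m, hm⟩ : ∃ m, p = m + 1 := ⟨p - 1, by have := hp.out.pos; omega⟩
  have h1 : β ^ p = p * β := by
    rw [← hβ, ← pow_succ]
    congr 1
    omega
  rw [hc, h1, inv_mul_cancel_left₀ hp0]

theorem isCyclic_quotient_inertia_levelField (E : IntermediateField K Kbar)
    [FiniteDimensional K E] : IsCyclic (Gal(E/K) ⧸ inertia p E) := by
  have := isAlgebraic_intermediateField (p := p) E
  obtain ⟨γ, hγ⟩ := exists_generator_mod_open (isInertia_inertia (p := p) E)
    (isOpen_discrete _) le_rfl
  refine ⟨QuotientGroup.mk γ, fun q => ?_⟩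
  obtain ⟨δ, rfl⟩ := QuotientGroup.mk_surjective q
  obtain ⟨i, hi⟩ := hγ δ
  refine Subgroup.mem_zpowers_iff.2 ⟨-i, ?_⟩
  have h1 := (QuotientGroup.eq_one_iff (N := inertia p E) _).2 hi
  rw [QuotientGroup.mk_mul, QuotientGroup.mk_zpow] at h1
  rw [zpow_neg]
  exact (eq_inv_of_mul_eq_one_left h1).symm

/-- The order of inertia is at most the number of points of a level, since it acts freely there. -/
theorem card_inertia_levelField_dvd (hβ : β ^ (p - 1) = p)
    (hc : absVal p Kbar (algebraMap K Kbar c) = β ^ p)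
    (ha : absVal p Kbar (algebraMap K Kbar a) < β ^ p) (n : ℕ) :
    Nat.card (inertia p (levelField Kbar (Polynomial.X ^ p - Polynomial.C c) a n)) ∣ p ^ n := by
  have : Algebra.IsAlgebraic K Kbar := IsAlgClosure.isAlgebraic
  have : IsAlgClosed Kbar := IsAlgClosure.isAlgClosed K
  set E := levelField Kbar (Polynomial.X ^ p - Polynomial.C c) a n
  have := isAlgebraic_intermediateField (p := p) E
  have : FiniteDimensional K E := finiteDimensional_levelField hp.out.ne_zero Kbar a c n
  have hE : GeneratedByLevels p E a c := generatedByLevels_levelField Kbar a c n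
  have hI := isInertia_inertia (p := p) E
  obtain ⟨k, hk⟩ := IsPGroup.iff_card.1
    (isPGroup_of_fixes_roots hE fun σ hσ => inertia_fixes_roots hβ hc E hσ)
  obtain ⟨z, hz⟩ := exists_iterate_root (p := p) (algebraMap K Kbar c) (algebraMap K Kbar a) n
  have hlev : ∀ y ∈ levelSet p Kbar a c n, y ∈ E := fun y hy =>
    IntermediateField.subset_adjoin K _ (by rw [preimages_eq_levelSet]; exact hy)
  let z' : E := ⟨z, hlev z hz⟩
  have hz' : z' ∈ levelSet p E a c n := (map_mem_levelSet_iff E.val).1 hz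
  have hcE : absVal p E (algebraMap K E c) = β ^ p := by rw [absVal_coe]; exact hc
  have haE : absVal p E (algebraMap K E a) < β ^ p := by rw [absVal_coe]; exact ha
  obtain ⟨hfin, hcard⟩ := finite_levelSet_and_ncard_le (K := K) (E := E) (a := a) (c := c)
    hp.out.ne_zero n
  have := hfin.to_subtype
  have hinj : Function.Injective fun σ : inertia p E =>
      (⟨σ.1 z', aut_mem_levelSet σ.1 hz'⟩ : levelSet p E a c n) := by
    intro σ τ hστ
    have h1 : σ.1 z' = τ.1 z' := congrArg Subtype.val hστ
    have h2 : (τ⁻¹ * σ).1 z' = z' := by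
      change τ.1⁻¹ (σ.1 z') = z'
      rw [h1]
      exact AlgEquiv.symm_apply_apply τ.1 z'
    have h3 : (τ⁻¹ * σ).1 = 1 := by
      have h4 : ∀ y ∈ levelSet p E a c n, (τ⁻¹ * σ).1 y = y := fun y hy =>
        inertia_free_on_levelSet hβ hcE haE hI (τ⁻¹ * σ).2 hz' hy h2
      refine AlgEquiv.coe_toAlgHom_injective ?_
      refine IntermediateField.algHom_ext_of_eq_adjoin K (S := E)
        (s := preimages Kbar (Polynomial.X ^ p - Polynomial.C c) a n) rfl fun y hy => ?_
      have hy' : y ∈ levelSet p Kbar a c n := by rwa [preimages_eq_levelSet] at hy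
      exact h4 ⟨y, hlev y hy'⟩ ((map_mem_levelSet_iff E.val).1 hy')
    exact (inv_mul_eq_one.1 (Subtype.ext h3 : τ⁻¹ * σ = 1)).symm
  have h1 : Nat.card (inertia p E) ≤ p ^ n :=
    (Nat.card_le_card_of_injective _ hinj).trans hcard
  rw [hk] at h1 ⊢
  exact pow_dvd_pow p ((Nat.pow_le_pow_iff_right hp.out.one_lt).1 h1)

end Conclusion

end Arboreal

theorem theorem5p1 (p : ℕ) [Fact p.Prime]
    -- `K` is a finite extension of `ℚ_p`, and `Kbar` is an algebraic closure of `K`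
    (K : Type*) [Field K] [Algebra ℚ_[p] K] [FiniteDimensional ℚ_[p] K]
    (Kbar : Type*) [Field Kbar] [Algebra K Kbar] [Algebra ℚ_[p] Kbar] [IsScalarTower ℚ_[p] K Kbar]
    [IsAlgClosure K Kbar]
    (a c : K) (f : Polynomial K) (hf : f = Polynomial.X ^ p - Polynomial.C c)
    (hc : Arboreal.val p (algebraMap K Kbar c) = ((-(p : ℝ) / ((p : ℝ) - 1) : ℝ) : WithTop ℝ))
    (b : Kbar) (hb : Polynomial.aeval b f = b) :
    -- if `μ_p ⊂ K`, then `G(n)/I(n)` is a cyclic `p`-group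
    ((∃ ζ : K, IsPrimitiveRoot ζ p) → ∀ n : ℕ,
      IsCyclic ((Arboreal.levelField Kbar f a n ≃ₐ[K] Arboreal.levelField Kbar f a n) ⧸
        Arboreal.inertia p (Arboreal.levelField Kbar f a n)) ∧
      IsPGroup p ((Arboreal.levelField Kbar f a n ≃ₐ[K] Arboreal.levelField Kbar f a n) ⧸
        Arboreal.inertia p (Arboreal.levelField Kbar f a n))) ∧
    -- `I(n)` is a `p`-group
    (∀ n : ℕ, IsPGroup p (Arboreal.inertia p (Arboreal.levelField Kbar f a n))) ∧
    -- if `v(a) > v(c)`, then `I(n)` is elementary abelian of order dividing `p ^ n`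
    (Arboreal.val p (algebraMap K Kbar c) < Arboreal.val p (algebraMap K Kbar a) → ∀ n : ℕ,
      Arboreal.IsElementaryAbelian p (Arboreal.inertia p (Arboreal.levelField Kbar f a n)) ∧
      Nat.card (Arboreal.inertia p (Arboreal.levelField Kbar f a n)) ∣ p ^ n) ∧
    -- if `μ_p ⊂ K`, then `G(∞)/I(∞)` is isomorphic to `ℤ_p` as a topological group
    ((∃ ζ : K, IsPrimitiveRoot ζ p) →
      Nonempty (((Arboreal.limitField Kbar f a ≃ₐ[K] Arboreal.limitField Kbar f a) ⧸
        Arboreal.inertia p (Arboreal.limitField Kbar f a)) ≃ₜ* Multiplicative ℤ_[p])) ∧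
    -- if `v(a - b) < 0`, then `I(∞)` is an infinite pro-`p` group, which is a countably infinite
    -- product of copies of `ℤ/pℤ` if moreover `v(a) > v(c)`
    (Arboreal.val p (algebraMap K Kbar a - b) < 0 →
      Infinite (Arboreal.inertia p (Arboreal.limitField Kbar f a)) ∧
      Arboreal.IsProP p (Arboreal.inertia p (Arboreal.limitField Kbar f a)) ∧
      (Arboreal.val p (algebraMap K Kbar c) < Arboreal.val p (algebraMap K Kbar a) →
        Nonempty (Arboreal.inertia p (Arboreal.limitField Kbar f a) ≃ₜ*
          Multiplicative (ℕ → ZMod p)))) ∧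
    -- if `v(a - b) ≥ 0`, then `I(∞)` is finite, and it is trivial if moreover `b ∈ K`
    (0 ≤ Arboreal.val p (algebraMap K Kbar a - b) →
      Finite (Arboreal.inertia p (Arboreal.limitField Kbar f a)) ∧
      (b ∈ Set.range (algebraMap K Kbar) →
        Arboreal.inertia p (Arboreal.limitField Kbar f a) = ⊥)) := by
  open Arboreal in
  subst hf
  have := isAlgebraic_padic p K Kbar
  have : Algebra.IsAlgebraic K Kbar := IsAlgClosure.isAlgebraic
  have : Normal K Kbar := IsAlgClosure.normal K Kbar
  have : CharZero K := charZero_of_injective_algebraMap (algebraMap ℚ_[p] K).injective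
  obtain ⟨β, hβ, hcβ⟩ := exists_absVal_eq_pow p hc
  have hb' : b ^ p - algebraMap K Kbar c = b := by simpa using hb
  have hβ1 := one_lt_of_pow_pred_eq hβ
  have hc0 : algebraMap K Kbar c ≠ 0 := by
    rw [← (absVal p Kbar).ne_zero_iff, hcβ]
    exact pow_ne_zero _ (zero_lt_one.trans hβ1).ne'
  have hac : val p (algebraMap K Kbar c) < val p (algebraMap K Kbar a) →
      absVal p Kbar (algebraMap K Kbar a) < β ^ p := fun h =>
    hcβ ▸ absVal_lt_of_val_lt p hc0 h
  set E := limitField Kbar (Polynomial.X ^ p - Polynomial.C c) a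
  have := isAlgebraic_intermediateField (p := p) E
  have : Normal K E := normal_limitField Kbar a c
  have : IsGalois K E := ⟨⟩
  have hgen : GeneratedByLevels p E a c := generatedByLevels_limitField Kbar a c
  have hI := isInertia_inertia (p := p) E
  have hpt : ∀ σ : Gal(E/K), (∀ η : E, η ^ p = 1 → σ η = η) → ∀ x : E, ∃ k, (σ ^ p ^ k) x = x :=
    fun σ hσ => exists_pow_apply_eq hgen hσ
  have hcE : absVal p E (algebraMap K E c) = β ^ p := by rw [absVal_coe]; exact hcβ
  have hfin := fun n => finiteDimensional_levelField (Fact.out : p.Prime).ne_zero Kbar a c n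
  refine ⟨fun hζ n => ?_, fun n => ?_, fun h n => ?_, fun hζ => ?_, fun h => ?_, fun h => ?_⟩
  · have := hfin n
    refine ⟨isCyclic_quotient_inertia_levelField _, ?_⟩
    have h1 : IsPGroup p (⊤ : Subgroup (_ ≃ₐ[K] _)) :=
      isPGroup_of_fixes_roots (generatedByLevels_levelField Kbar a c n)
        fun σ _ => fixes_roots_of_isPrimitiveRoot hζ σ
    exact (h1.of_equiv Subgroup.topEquiv).to_quotient _
  · have := hfin n
    exact isPGroup_of_fixes_roots (generatedByLevels_levelField Kbar a c n)
      fun σ hσ => inertia_fixes_roots hβ hcβ _ hσ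
  · have := isAlgebraic_intermediateField (p := p)
      (levelField Kbar (Polynomial.X ^ p - Polynomial.C c) a n)
    refine ⟨isElementaryAbelian_inertia hβ ?_ ?_ (isInertia_inertia _)
      (generatedByLevels_levelField Kbar a c n), card_inertia_levelField_dvd hβ hcβ (hac h) n⟩
    · rw [absVal_coe]; exact hcβ
    · rw [absVal_coe]; exact hac h
  · exact nonempty_quotient_inertia_continuousMulEquiv hI
      (fun σ => hpt σ (fixes_roots_of_isPrimitiveRoot hζ σ))
      (exists_finset_incongruent_limitField hβ hcβ)
  · have hab : 1 < absVal p Kbar (algebraMap K Kbar a - b) := by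
      by_contra! hle
      exact absurd ((val_nonneg_iff p _).2 hle) (not_le.2 h)
    have hinf := infinite_inertia_of_absVal hI hpt hab
      (exists_absVal_pow_eq_limitField hβ hcβ hb' hab)
    refine ⟨hinf, isProP_of_isClosed (isClosed_inertia hI)
      (fun σ hσ => hpt σ (inertia_fixes_roots hβ hcβ E hσ)), fun h' => ?_⟩
    refine nonempty_inertia_continuousMulEquiv_pi hI (isElementaryAbelian_inertia hβ hcE ?_ hI hgen)
      hgen
    rw [absVal_coe]; exact hac h'
  · have hab := (val_nonneg_iff p _).1 h
    have hvb := val_fixedPoint _ hβ hcβ hb'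
    have ha : absVal p Kbar (algebraMap K Kbar a) < β ^ p := by
      rw [← sub_add_cancel (algebraMap K Kbar a) b]
      have h1 := lt_pow_self_of_prime (p := p) hβ
      exact Valuation.map_add_lt _ (hab.trans_lt (hβ1.trans h1)) (hvb.trans_lt h1)
    -- All points of the tree are congruent to `a` modulo integers, so inertia fixes them. This does
    -- not need `b` to lie in `K`.
    have hbot : inertia p E = ⊥ := by
      refine inertia_eq_bot_of_integral hβ hcE (by rw [absVal_coe]; exact ha) hI hgen ?_
      intro m z hz
      rw [absVal_coe]
      have h1 := val_sub_fixedPoint_le_one _ (absVal_natCast_prime p) hβ hcβ hb' hab m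
        ((map_mem_levelSet_iff E.val).2 hz)
      have h2 : ((z - algebraMap K E a : E) : Kbar) =
          (z - b) - (algebraMap K Kbar a - b) := (sub_sub_sub_cancel_right _ _ _).symm
      rw [h2]
      exact Valuation.map_sub_le _ h1 hab
    rw [hbot]
    exact ⟨inferInstance, fun _ => rfl⟩
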